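/- Let $\mathcal E$ be a finite-dimensional Euclidean space with inner product $\langle\cdot,\cdot\rangle$ and let $\mathcal Q\subset\mathcal E$ be a smooth embedded submanifold, with tangent spaces $T_q\mathcal Q\subset\mathcal E$. For a function $f$ on $\mathcal Q$ with values in a vector space, $f'(q;\xi)=\mathrm D_\xi f(q)$ denotes the directional derivative at $q$ along $\xi\in T_q\mathcal Q$. Let $\mathsf g$ be a metric operator on $\mathcal Q$: a smooth family of invertible symmetric operators $\mathsf g(q)$ on $\mathcal E$ whose pairing $\langle v,w\rangle_{\mathsf g}=\langle v,\mathsf g(q)w\rangle$ is nondegenerate on every $T_q\mathcal Q$ (a semi-Riemannian metric on $\mathcal Q$; the Riemannian case is that of a positive definite pairing). Let $\mathcal B$ be a smooth manifold with a smooth semi-Riemannian metric and let $\mathfrak q:\mathcal Q\to\mathcal B$ be a Riemannian submersion: $\mathfrak q$ is a smooth submersion, $\langle\cdot,\cdot\rangle_{\mathsf g}$ is nondegenerate on each vertical space $\mathcal V_q=\ker\mathfrak q'(q)\subset T_q\mathcal Q$, and $\mathfrak q'(q)$ is isometric on the horizontal space $\mathcal H_q$, the $\mathsf g$-orthogonal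 complement of $\mathcal V_q$ in $T_q\mathcal Q$. Let $\mathtt H(q),\mathtt V(q):\mathcal E\to\mathcal E$ be the $\mathsf g$-self-adjoint projections onto $\mathcal H_q$ and $\mathcal V_q$, and for $\omega\in\mathcal E$ let $\mathtt h_\omega$ be the vector field $y\mapsto\mathtt H(y)\omega$ on $\mathcal Q$. Let $\nabla$ be the Levi-Civita connection of $(\mathcal Q,\mathsf g)$, with Christoffel function $\Gamma$, extended bilinearly and smoothly to $\mathcal E$, so that $\nabla_XY=\mathrm D_XY+\Gamma(X,Y)$ for vector fields $X,Y$ on $\mathcal Q$. Curvatures are taken with the sign $R_{XY}=\nabla_X\nabla_Y-\nabla_Y\nabla_X-\nabla_{[X,Y]}$. For $q\in\mathcal Q$, $\xi\in\mathcal H_q$, $\omega\in\mathcal E$ define $$A_\xi(q)\omega:=\mathtt V(q)(\nabla_{\mathtt h_\xi}\mathtt h_\omega)_{y=q},\qquad A^\dagger_\xi(q)\omega:=-\mathtt H(q)(\nabla_\xi(\mathtt V(y)\omega))_{y=q}.$$ 1. For all $q\in\mathcal Q$, $\xi\in\mathcal H_q$, $\omega\in\mathcal E$, $$A_\xi(q)\omega=-\mathtt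 V'(q;\xi)\mathtt H(q)\omega+\mathtt V(q)\Gamma(q;\xi,\mathtt H(q)\omega),\qquad A^\dagger_\xi(q)\omega=\mathtt H'(q;\xi)\mathtt V(q)\omega-\mathtt H(q)\Gamma(q;\xi,\mathtt V(q)\omega),$$ and $A_\xi$, $A_\xi^\dagger$ are adjoint: $\langle A_\xi\omega_1,\omega_2\rangle_{\mathsf g}=\langle\omega_1,A^\dagger_\xi\omega_2\rangle_{\mathsf g}$ for all $\omega_1,\omega_2\in\mathcal E$. 2. For $\xi,\omega\in\mathcal H_q$, $A_\xi\omega$ is the value at $q$ of O'Neill's tensor $\mathtt H\nabla_{\mathtt HX}(\mathtt VY)+\mathtt V\nabla_{\mathtt HX}(\mathtt HY)$ for any smooth vector fields $X,Y$ on $\mathcal Q$ with $X(q)=\xi$, $Y(q)=\omega$. 3. For $\xi,\eta\in\mathcal H_q$, $A_\xi(q)\eta=\tfrac12\mathtt V(q)[\mathtt h_\xi,\mathtt h_\eta]_{y=q}=\tfrac12\{\mathtt H'(q;\xi)\eta-\mathtt H'(q;\eta)\xi\}$. 4. $\nabla^{\mathcal H}_XY:=\mathtt H\nabla_XY$, for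 $X$ a vector field and $Y$ a horizontal vector field on $\mathcal Q$, is a connection on the horizontal bundle $\mathcal H$, and it has a smooth Christoffel function $\Gamma^{\mathcal H}$ with values in the bilinear maps $\mathcal E\times\mathcal E\to\mathcal E$, that is, $\nabla^{\mathcal H}_XY=\mathrm D_XY+\Gamma^{\mathcal H}(X,Y)$. 5. Let $q\in\mathcal Q$ and $\xi,\eta,\phi\in\mathcal H_q$, and let $\bar R^{\mathcal B}_{\xi\eta}\phi\in\mathcal H_q$ be the unique horizontal lift to $q$ of $R^{\mathcal B}_{\mathfrak q'(q)\xi,\,\mathfrak q'(q)\eta}\,\mathfrak q'(q)\phi$, where $R^{\mathcal B}$ is the Riemannian curvature of $\mathcal B$. Then for every Christoffel function $\Gamma^{\mathcal H}$ as in 4, $$\bar R^{\mathcal B}_{\xi\eta}\phi=(\mathrm D_\xi\Gamma^{\mathcal H})(\eta,\phi)-(\mathrm D_\eta\Gamma^{\mathcal H})(\xi,\phi)+\Gamma^{\mathcal H}(\xi,\Gamma^{\mathcal H}(\eta,\phi))-\Gamma^{\mathcal H}(\eta,\Gamma^{\mathcal H}(\xi,\phi))-2A^\dagger_\phi A_\xi\eta,$$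 and, with $R^{\mathcal Q}$ the Riemannian curvature of $(\mathcal Q,\mathsf g)$, computed at $q$ from any smooth vector fields extending $\xi,\eta,\phi$, $$\bar R^{\mathcal B}_{\xi\eta}\phi=\mathtt H(q)R^{\mathcal Q}_{\xi\eta}\phi-2A^\dagger_\phi A_\xi\eta+A^\dagger_\xi A_\eta\phi+A^\dagger_\eta A_\phi\xi.$$ -/

import Mathlib

open scoped Manifold ContDiff Topology

noncomputable section

namespace EmbeddedGeometry

section Embedded

variable {E : Type*} [NormedAddCommGroup E] [InnerProductSpace ℝ E]

/-- `Q` is a smooth embedded submanifold of dimension `d` of `E`: around each of its points a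
smooth diffeomorphism between open sets of `E` straightens `Q` to a `d`-dimensional linear
subspace. -/
def IsEmbeddedSubmanifold (d : ℕ) (Q : Set E) : Prop :=
  ∀ x ∈ Q, ∃ (Φ : OpenPartialHomeomorph E E) (S : Submodule ℝ E),
    x ∈ Φ.source ∧ ContDiffOn ℝ ∞ Φ Φ.source ∧ ContDiffOn ℝ ∞ Φ.symm Φ.target ∧
    Module.finrank ℝ S = d ∧ ∀ y ∈ Φ.source, (y ∈ Q ↔ Φ y ∈ S)

/-- The tangent space `T_x Q ⊆ E`, spanned by the velocities at `x` of smooth curves in `Q`.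

Directional derivatives of functions on `Q` along `ξ ∈ T_x Q` are written
`fderivWithin ℝ f Q x ξ`; for `f` differentiable on `Q` and `ξ` tangent, the value depends only on
the restriction of `f` to `Q`. Likewise `ContDiffOn ℝ ∞ f Q` says that `f` restricts to a smooth
function on the submanifold `Q`. -/
def tangentSpaceAt (Q : Set E) (x : E) : Submodule ℝ E :=
  Submodule.span ℝ {v | ∃ γ : ℝ → E, ContDiffAt ℝ ∞ γ 0 ∧ γ 0 = x ∧
    (∀ᶠ t in 𝓝 (0 : ℝ), γ t ∈ Q) ∧ deriv γ 0 = v}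

/-- A smooth section over `Q` of the bundle with fibres `W x ⊆ E`. -/
def IsSmoothSection (Q : Set E) (W : E → Submodule ℝ E) (s : E → E) : Prop :=
  ContDiffOn ℝ ∞ s Q ∧ ∀ x ∈ Q, s x ∈ W x

/-- A smooth tangent vector field on `Q`. -/
def IsVectorField (Q : Set E) (X : E → E) : Prop :=
  IsSmoothSection Q (tangentSpaceAt Q) X

/-- A metric operator on `Q`: a smooth family of invertible symmetric operators `g x` of `E` such
that the pairing `⟨v, g x w⟩` is nondegenerate on each `T_x Q`. It induces a semi-Riemannian metric
on `Q`. -/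
structure IsMetricOperator (Q : Set E) (g : E → E →L[ℝ] E) : Prop where
  contDiffOn : ContDiffOn ℝ ∞ g Q
  symm : ∀ x ∈ Q, ∀ v w : E, inner ℝ (g x v) w = inner ℝ v (g x w)
  invertible : ∀ x ∈ Q, (g x).IsInvertible
  nondegenerate : ∀ x ∈ Q, ∀ v ∈ tangentSpaceAt Q x,
    (∀ w ∈ tangentSpaceAt Q x, inner ℝ v (g x w) = 0) → v = 0

/-- The projection of `E` onto `W` that is self-adjoint for the pairing `⟨v, G w⟩`, given by
`ψ (ψᵗ G ψ)⁻¹ ψᵗ G` with `ψ` the inclusion of `W` (assuming that the pairing is nondegenerate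
on `W`). -/
def metricProjection [FiniteDimensional ℝ E] (G : E →L[ℝ] E) (W : Submodule ℝ E) : E →L[ℝ] E :=
  W.subtypeL ∘L
    (ContinuousLinearMap.inverse (W.subtypeL.adjoint ∘L G ∘L W.subtypeL)) ∘L
    W.subtypeL.adjoint ∘L G

/-- A connection (covariant derivative) `D X s = ∇_X s` on the bundle over `Q` with fibres
`W x ⊆ E`. -/
structure IsConnection (Q : Set E) (W : E → Submodule ℝ E) (D : (E → E) → (E → E) → E → E) :
    Prop where
  isSection : ∀ X s, IsVectorField Q X → IsSmoothSection Q W s → IsSmoothSection Q W (D X s)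
  add_left : ∀ X X' s, IsVectorField Q X → IsVectorField Q X' → IsSmoothSection Q W s →
    ∀ x ∈ Q, D (fun y => X y + X' y) s x = D X s x + D X' s x
  smul_left : ∀ (f : E → ℝ) X s, ContDiffOn ℝ ∞ f Q → IsVectorField Q X →
    IsSmoothSection Q W s → ∀ x ∈ Q, D (fun y => f y • X y) s x = f x • D X s x
  add_right : ∀ X s s', IsVectorField Q X → IsSmoothSection Q W s → IsSmoothSection Q W s' →
    ∀ x ∈ Q, D X (fun y => s y + s' y) x = D X s x + D X s' x
  leibniz : ∀ (f : E → ℝ) X s, ContDiffOn ℝ ∞ f Q → IsVectorField Q X →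
    IsSmoothSection Q W s → ∀ x ∈ Q,
      D X (fun y => f y • s y) x = fderivWithin ℝ f Q x (X x) • s x + f x • D X s x

/-- `Γ` is a Christoffel function, extended bilinearly and smoothly to `E`, of the connection `D`
on the bundle with fibres `W x`: `∇_X s = D_X s + Γ(X, s)`. -/
structure IsChristoffelFunction (Q : Set E) (W : E → Submodule ℝ E)
    (D : (E → E) → (E → E) → E → E) (Γ : E → E →L[ℝ] E →L[ℝ] E) : Prop where
  contDiffOn : ContDiffOn ℝ ∞ Γ Q
  eq : ∀ X s, IsVectorField Q X → IsSmoothSection Q W s →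
    ∀ x ∈ Q, D X s x = fderivWithin ℝ s Q x (X x) + Γ x (X x) (s x)

/-- `(∇_ξ s)_x = D_ξ s + Γ(x; ξ, s x)`. -/
def covDerivAt (Q : Set E) (Γ : E → E →L[ℝ] E →L[ℝ] E) (x ξ : E) (s : E → E) : E :=
  fderivWithin ℝ s Q x ξ + Γ x ξ (s x)

/-- `∇_X s = D_X s + Γ(X, s)`. -/
def covDeriv (Q : Set E) (Γ : E → E →L[ℝ] E →L[ℝ] E) (X s : E → E) : E → E :=
  fun x => covDerivAt Q Γ x (X x) s

/-- `D` is the Levi-Civita connection of `(Q, g)`: a torsion-free, metric compatible connection on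
`TQ`. -/
structure IsLeviCivita (Q : Set E) (g : E → E →L[ℝ] E) (D : (E → E) → (E → E) → E → E) :
    Prop where
  isConnection : IsConnection Q (tangentSpaceAt Q) D
  torsion_free : ∀ X Y, IsVectorField Q X → IsVectorField Q Y →
    ∀ x ∈ Q, D X Y x - D Y X x = VectorField.lieBracketWithin ℝ X Y Q x
  metric_compatible : ∀ X Y Z, IsVectorField Q X → IsVectorField Q Y → IsVectorField Q Z →
    ∀ x ∈ Q, fderivWithin ℝ (fun y => inner ℝ (Y y) (g y (Z y))) Q x (X x) =
      inner ℝ (D X Y x) (g x (Z x)) + inner ℝ (Y x) (g x (D X Z x))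

/-- `R_{XY} Z = ∇_X ∇_Y Z - ∇_Y ∇_X Z - ∇_{[X,Y]} Z`. -/
def curvature (Q : Set E) (D : (E → E) → (E → E) → E → E) (X Y Z : E → E) : E → E :=
  fun x => D X (D Y Z) x - D Y (D X Z) x - D (VectorField.lieBracketWithin ℝ X Y Q) Z x

/-- `(D_ξ Γ)(η, φ) - (D_η Γ)(ξ, φ) + Γ(ξ, Γ(η, φ)) - Γ(η, Γ(ξ, φ))` at `x`. -/
def christoffelCurvature (Q : Set E) (Γ : E → E →L[ℝ] E →L[ℝ] E) (x ξ η φ : E) : E :=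
  fderivWithin ℝ Γ Q x ξ η φ - fderivWithin ℝ Γ Q x η ξ φ
    + Γ x ξ (Γ x η φ) - Γ x η (Γ x ξ φ)

end Embedded

section Base

variable (F : Type*) [NormedAddCommGroup F] [NormedSpace ℝ F]
  (B : Type*) [TopologicalSpace B] [ChartedSpace F B] [IsManifold 𝓘(ℝ, F) ∞ B]

/-- A smooth semi-Riemannian metric on the manifold `B`. -/
structure SemiRiemannianMetric where
  /-- the scalar product on each tangent space -/
  val : ∀ b : B, TangentSpace 𝓘(ℝ, F) b →L[ℝ] TangentSpace 𝓘(ℝ, F) b →L[ℝ] ℝ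
  symm : ∀ b v w, val b v w = val b w v
  nondegenerate : ∀ b v, (∀ w, val b v w = 0) → v = 0
  contMDiff : ContMDiff 𝓘(ℝ, F) (𝓘(ℝ, F).prod 𝓘(ℝ, F →L[ℝ] F →L[ℝ] ℝ)) ∞
    (fun b => Bundle.TotalSpace.mk' (F →L[ℝ] F →L[ℝ] ℝ)
      (E := fun b : B => TangentSpace 𝓘(ℝ, F) b →L[ℝ] TangentSpace 𝓘(ℝ, F) b →L[ℝ] ℝ) b (val b))

variable {F B}

namespace SemiRiemannianMetric

/-- The metric in the coordinates of the chart at `b`, at the coordinate point `y`. -/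
def coord (h : SemiRiemannianMetric F B) (b : B) (y : F) : F →L[ℝ] F →L[ℝ] ℝ :=
  let A : F →L[ℝ] TangentSpace 𝓘(ℝ, F) ((extChartAt 𝓘(ℝ, F) b).symm y) :=
    mfderiv 𝓘(ℝ, F) 𝓘(ℝ, F) (extChartAt 𝓘(ℝ, F) b).symm y
  ContinuousLinearMap.precomp ℝ A ∘L h.val ((extChartAt 𝓘(ℝ, F) b).symm y) ∘L A

/-- The Christoffel symbols of the Levi-Civita connection in the chart at `b`: `Γ(y; u, v)` is
the vector with `2 ⟨Γ(u, v), z⟩ = (D_u h)(v, z) + (D_v h)(u, z) - (D_z h)(u, v)` for all `z`. -/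
def christoffel (h : SemiRiemannianMetric F B) (b : B) (y u v : F) : F :=
  (h.coord b y).inverse
    ((1 / 2 : ℝ) • (fderiv ℝ (h.coord b) y u v + fderiv ℝ (h.coord b) y v u
      - ((fderiv ℝ (h.coord b) y).flip u).flip v))

/-- The coordinate expression of the Riemannian curvature `R_{uv} w` in the chart at `b`, at the
coordinate point of `b`. -/
def coordCurvature (h : SemiRiemannianMetric F B) (b : B) (u v w : F) : F :=
  let y := extChartAt 𝓘(ℝ, F) b b
  fderiv ℝ (fun z => h.christoffel b z v w) y u - fderiv ℝ (fun z => h.christoffel b z u w) y v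
    + h.christoffel b y u (h.christoffel b y v w) - h.christoffel b y v (h.christoffel b y u w)

/-- The Riemannian curvature `R_{uv} w` of `(B, h)` at `b`, with the sign convention
`R_{XY} = ∇_X ∇_Y - ∇_Y ∇_X - ∇_{[X,Y]}`: the vector with coordinates
`coordCurvature` in the chart at `b`. -/
def curvature (h : SemiRiemannianMetric F B) (b : B) (u v w : TangentSpace 𝓘(ℝ, F) b) :
    TangentSpace 𝓘(ℝ, F) b :=
  let c : TangentSpace 𝓘(ℝ, F) b →L[ℝ] F :=
    mfderiv 𝓘(ℝ, F) 𝓘(ℝ, F) (extChartAt 𝓘(ℝ, F) b) b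
  c.inverse (h.coordCurvature b (c u) (c v) (c w))

end SemiRiemannianMetric

end Base

section Submersion

variable {E : Type*} [NormedAddCommGroup E] [InnerProductSpace ℝ E]
  {F : Type*} [NormedAddCommGroup F] [NormedSpace ℝ F]
  {B : Type*} [TopologicalSpace B] [ChartedSpace F B]

variable (F) in
/-- The differential of `π : Q → B` at `x` (meaningful on `T_x Q`). -/
def diff (Q : Set E) (π : E → B) (x : E) : E →L[ℝ] TangentSpace 𝓘(ℝ, F) (π x) :=
  mfderivWithin 𝓘(ℝ, E) 𝓘(ℝ, F) π Q x

variable (F) in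
/-- The vertical space `V_x = ker dπ_x ⊆ T_x Q`. -/
def vertical (Q : Set E) (π : E → B) (x : E) : Submodule ℝ E :=
  tangentSpaceAt Q x ⊓ (diff F Q π x).ker

variable (F) in
/-- The horizontal space: the orthogonal complement of `V_x` in `T_x Q` for the metric `g x`. -/
def horizontal (Q : Set E) (g : E → E →L[ℝ] E) (π : E → B) (x : E) : Submodule ℝ E where
  carrier := {v | v ∈ tangentSpaceAt Q x ∧ ∀ w ∈ vertical F Q π x, inner ℝ w (g x v) = 0}
  add_mem' := fun ha hb => ⟨add_mem ha.1 hb.1, fun w hw => by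
    rw [map_add, inner_add_right, ha.2 w hw, hb.2 w hw, add_zero]⟩
  zero_mem' := ⟨zero_mem _, fun w _ => by rw [map_zero, inner_zero_right]⟩
  smul_mem' := fun c v hv => ⟨Submodule.smul_mem _ c hv.1, fun w hw => by
    rw [map_smul, inner_smul_right, hv.2 w hw, mul_zero]⟩

/-- `π : Q → B` is a (semi-)Riemannian submersion from `(Q, g)` to `(B, h)`: a smooth submersion
whose vertical spaces are nondegenerate and whose differential is isometric on the horizontal
spaces. -/
structure IsRiemannianSubmersion [IsManifold 𝓘(ℝ, F) ∞ B] (Q : Set E) (g : E → E →L[ℝ] E)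
    (π : E → B) (h : SemiRiemannianMetric F B) : Prop where
  contMDiffOn : ContMDiffOn 𝓘(ℝ, E) 𝓘(ℝ, F) ∞ π Q
  surjective : ∀ x ∈ Q, ∀ u : TangentSpace 𝓘(ℝ, F) (π x),
    ∃ v ∈ tangentSpaceAt Q x, diff F Q π x v = u
  nondegenerate : ∀ x ∈ Q, ∀ v ∈ vertical F Q π x,
    (∀ w ∈ vertical F Q π x, inner ℝ v (g x w) = 0) → v = 0
  isometry : ∀ x ∈ Q, ∀ v ∈ horizontal F Q g π x, ∀ w ∈ horizontal F Q g π x,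
    h.val (π x) (diff F Q π x v) (diff F Q π x w) = inner ℝ v (g x w)

variable (F) in
/-- `v` is a horizontal lift to `x` of the tangent vector `u` of `B` at `π x`. -/
def IsHorizontalLift (Q : Set E) (g : E → E →L[ℝ] E) (π : E → B) (x : E)
    (u : TangentSpace 𝓘(ℝ, F) (π x)) (v : E) : Prop :=
  v ∈ horizontal F Q g π x ∧ diff F Q π x v = u

variable [FiniteDimensional ℝ E]

variable (F) in
/-- The horizontal projection `H(x)` of `E`. -/
def hProj (Q : Set E) (g : E → E →L[ℝ] E) (π : E → B) (x : E) : E →L[ℝ] E :=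
  metricProjection (g x) (horizontal F Q g π x)

variable (F) in
/-- The vertical projection `V(x)` of `E`. -/
def vProj (Q : Set E) (g : E → E →L[ℝ] E) (π : E → B) (x : E) : E →L[ℝ] E :=
  metricProjection (g x) (vertical F Q π x)

variable (F) in
/-- `A_ξ(x) v = V(x) (∇_{h_ξ} h_v)_x`, where `h_v` is the field `y ↦ H(y) v`. -/
def tensorA (Q : Set E) (g : E → E →L[ℝ] E) (π : E → B) (Γ : E → E →L[ℝ] E →L[ℝ] E)
    (x ξ v : E) : E :=
  vProj F Q g π x
    (covDeriv Q Γ (fun y => hProj F Q g π y ξ) (fun y => hProj F Q g π y v) x)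

variable (F) in
/-- `A†_ξ(x) v = - H(x) (∇_ξ V(y) v)_{y = x}`. -/
def tensorAdag (Q : Set E) (g : E → E →L[ℝ] E) (π : E → B) (Γ : E → E →L[ℝ] E →L[ℝ] E)
    (x ξ v : E) : E :=
  - hProj F Q g π x (covDerivAt Q Γ x ξ (fun y => vProj F Q g π y v))

variable (F) in
/-- O'Neill's tensor `A_X Y = H ∇_{HX} (V Y) + V ∇_{HX} (H Y)` for vector fields `X`, `Y`
on `Q`. -/
def oneillTensor (Q : Set E) (g : E → E →L[ℝ] E) (π : E → B) (Γ : E → E →L[ℝ] E →L[ℝ] E)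
    (X Y : E → E) : E → E :=
  fun x =>
    hProj F Q g π x
      (covDeriv Q Γ (fun y => hProj F Q g π y (X y)) (fun y => vProj F Q g π y (Y y)) x) +
    vProj F Q g π x
      (covDeriv Q Γ (fun y => hProj F Q g π y (X y)) (fun y => hProj F Q g π y (Y y)) x)

variable (F) in
/-- `∇^H_X Y = H ∇_X Y`. -/
def hConnection (Q : Set E) (g : E → E →L[ℝ] E) (π : E → B) (Γ : E → E →L[ℝ] E →L[ℝ] E)
    (X Y : E → E) : E → E :=
  fun x => hProj F Q g π x (covDeriv Q Γ X Y x)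

end Submersion

end EmbeddedGeometry

end

open EmbeddedGeometry

/-!
All claims are reduced to identities between derivatives along tangent vectors.

*Calculus on `Q`.* Near each of its points `Q` is the image of a smooth retraction `r` of an open
set of `E` (`IsEmbeddedSubmanifold.isLocalRetract`), and `T_x Q` is the fixed space of `Dr(x)`.
Hence a function `f` on `Q` has, along tangent vectors, the derivative of `f ∘ r`
(`IsLocalRetract.fderivWithin_eq_fderiv_comp`): although `Q` is not a set of unique
differentiability, `fderivWithin` obeys the usual rules there, `[X, Y]` is tangent and
`D_X D_Y - D_Y D_X = D_[X,Y]`. It follows that for every smooth bilinear `Γ` the curvature of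
`D + Γ` is `christoffelCurvature` (`IsLocalRetract.curvature_covDeriv`), whatever the extensions of
the arguments.

*Projections.* The vertical spaces are kernels of a submersion, hence ranges of a smooth family of
projections, and then their metric projections are smooth as well
(`contDiffOn_metricProjection`); so are the tangent and the horizontal projections. Differentiating
`HH = H`, `HV = 0`, `VH = 0` and `⟨H v, V w⟩ = 0` gives the expressions of `A`, `A†` and their
adjointness.

*Basic fields.* In a chart of `B`, let `L(x) : F → E` be the horizontal lift. The fields `L u` have
brackets with each other and with vertical fields that are vertical. With the Koszul formula this
gives `H ∇_{L u} (L v) = L (Γ^B(u, v))` (`IsLift.H_covDerivAt_L`) and `A_ξ η = - A_η ξ` on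
horizontal vectors (`IsLift.splitA_L_add`), hence `V [X, Y] = 2 A_X Y`. The curvature of `H ∇` on
basic fields is then the lift of the curvature of `B`, up to the contribution of the vertical vector
`U = 2 A_X Y` in `∇_[X,Y] Z`, which is `H ∇_U Z = H ∇_Z U = - A†_Z U`
(`IsLift.christoffelCurvature_L`).

*O'Neill's formula.* The curvature of `H ∇` and the horizontal part of the curvature of `∇` differ
by the Gauss terms `A†_ξ A_η φ - A†_η A_ξ φ` (`IsSplitting.H_christoffelCurvature`).
-/

namespace EmbeddedGeometry

open Set

/-! ### Calculus along a local retract -/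

section Calculus

variable {E : Type*} [NormedAddCommGroup E] [InnerProductSpace ℝ E]
  {G : Type*} [NormedAddCommGroup G] [NormedSpace ℝ G]
  {G' : Type*} [NormedAddCommGroup G'] [NormedSpace ℝ G']

/-- `r` is a smooth retraction of the open set `U` of `E` into `Q`, the identity on `Q ∩ U`. -/
structure IsRetractionOn (Q U : Set E) (r : E → E) : Prop where
  isOpen : IsOpen U
  contDiffOn : ContDiffOn ℝ ∞ r U
  mapsTo : MapsTo r U Q
  eq_self : ∀ x ∈ Q, x ∈ U → r x = x

/-- `Q` is locally a smooth retract of open sets of `E`: all that is used of an embedded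
submanifold. -/
def IsLocalRetract (Q : Set E) : Prop :=
  ∀ x ∈ Q, ∃ (U : Set E) (r : E → E), x ∈ U ∧ IsRetractionOn Q U r

/-- In a straightening chart, a linear projection onto the model subspace is a retraction. -/
theorem IsEmbeddedSubmanifold.isLocalRetract [FiniteDimensional ℝ E] {d : ℕ} {Q : Set E}
    (hQ : IsEmbeddedSubmanifold d Q) : IsLocalRetract Q := by
  intro x hx
  obtain ⟨Φ, S, hxs, hΦ, hΦ', -, hS⟩ := hQ x hx
  let P : E →L[ℝ] E := S.starProjection
  have hcont : ContinuousOn (fun y => P (Φ y)) Φ.source :=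
    P.continuous.comp_continuousOn Φ.continuousOn
  have hself : ∀ y ∈ Q, y ∈ Φ.source → P (Φ y) = Φ y := fun y hy hys =>
    Submodule.starProjection_eq_self_iff.2 ((hS y hys).1 hy)
  refine ⟨Φ.source ∩ (fun y => P (Φ y)) ⁻¹' Φ.target, fun y => Φ.symm (P (Φ y)), ⟨hxs, ?_⟩, ?_⟩
  · change P (Φ x) ∈ Φ.target
    rw [hself x hx hxs]
    exact Φ.map_source hxs
  · refine ⟨hcont.isOpen_inter_preimage Φ.open_source Φ.open_target, ?_, ?_, ?_⟩
    · refine hΦ'.comp (P.contDiff.comp_contDiffOn (hΦ.mono inter_subset_left)) fun y hy => hy.2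
    · intro y hy
      refine (hS _ (Φ.map_target hy.2)).2 ?_
      rw [Φ.right_inv hy.2]
      exact Submodule.starProjection_apply_mem _ _
    · intro y hy hyU
      rw [hself y hy hyU.1, Φ.left_inv hyU.1]

theorem IsLocalRetract.inter_isOpen {Q U : Set E} (hQ : IsLocalRetract Q) (hU : IsOpen U) :
    IsLocalRetract (Q ∩ U) := by
  rintro x ⟨hx, hxU⟩
  obtain ⟨W, r, hxW, hr⟩ := hQ x hx
  refine ⟨(W ∩ r ⁻¹' U), r, ⟨hxW, ?_⟩,
    hr.contDiffOn.continuousOn.isOpen_inter_preimage hr.isOpen hU,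
    hr.contDiffOn.mono inter_subset_left, fun y hy => ⟨hr.mapsTo hy.1, hy.2⟩,
    fun y hy hyW => hr.eq_self y hy.1 hyW.1⟩
  change r x ∈ U
  rwa [hr.eq_self x hx hxW]

theorem tangentSpaceAt_inter_isOpen {Q U : Set E} (hU : IsOpen U) {x : E} (hx : x ∈ U) :
    tangentSpaceAt (Q ∩ U) x = tangentSpaceAt Q x := by
  unfold tangentSpaceAt
  congr 1
  ext v
  constructor
  · rintro ⟨γ, h1, h2, h3, h4⟩
    exact ⟨γ, h1, h2, h3.mono fun t ht => ht.1, h4⟩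
  · rintro ⟨γ, h1, h2, h3, h4⟩
    refine ⟨γ, h1, h2, h3.and (h1.continuousAt.eventually_mem ?_), h4⟩
    rw [h2]
    exact hU.mem_nhds hx

namespace IsRetractionOn

variable {Q U : Set E} {r : E → E}

theorem hasFDerivAt (hr : IsRetractionOn Q U r) {x : E} (hx : x ∈ U) :
    HasFDerivAt r (fderiv ℝ r x) x :=
  ((hr.contDiffOn.contDiffAt (hr.isOpen.mem_nhds hx)).differentiableAt (by simp)).hasFDerivAt

theorem hasFDerivAt_comp (hr : IsRetractionOn Q U r) {x : E} (hxQ : x ∈ Q) (hx : x ∈ U)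
    {f : E → G} {f' : E →L[ℝ] G} (hf : HasFDerivWithinAt f f' Q x) :
    HasFDerivAt (f ∘ r) (f' ∘L fderiv ℝ r x) x := by
  rw [← hr.eq_self x hxQ hx] at hf
  have := hf.comp x (hr.hasFDerivAt hx).hasFDerivWithinAt hr.mapsTo
  exact this.hasFDerivAt (hr.isOpen.mem_nhds hx)

theorem contDiffOn_comp (hr : IsRetractionOn Q U r) {f : E → G} (hf : ContDiffOn ℝ ∞ f Q) :
    ContDiffOn ℝ ∞ (f ∘ r) U :=
  hf.comp hr.contDiffOn hr.mapsTo

theorem fderiv_mem (hr : IsRetractionOn Q U r) {x : E} (hxQ : x ∈ Q) (hx : x ∈ U) (v : E) :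
    fderiv ℝ r x v ∈ tangentSpaceAt Q x := by
  have hline : ContDiff ℝ ∞ (fun t : ℝ => x + t • v) := by fun_prop
  have h0 : x + (0 : ℝ) • v = x := by simp
  have hrx : ContDiffAt ℝ ∞ r (x + (0 : ℝ) • v) := by
    rw [h0]
    exact hr.contDiffOn.contDiffAt (hr.isOpen.mem_nhds hx)
  refine Submodule.subset_span ⟨fun t => r (x + t • v), hrx.comp 0 hline.contDiffAt, ?_, ?_, ?_⟩
  · simpa using hr.eq_self x hxQ hx
  · have : ∀ᶠ t in 𝓝 (0 : ℝ), x + t • v ∈ U :=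
      hline.continuous.continuousAt.eventually_mem (by rw [h0]; exact hr.isOpen.mem_nhds hx)
    exact this.mono fun t ht => hr.mapsTo ht
  · have h1 : HasDerivAt (fun t : ℝ => x + t • v) v 0 := by
      simpa using ((hasDerivAt_id (0 : ℝ)).smul_const v).const_add x
    have h2 : HasFDerivAt r (fderiv ℝ r x) (x + (0 : ℝ) • v) := by
      rw [h0]
      exact hr.hasFDerivAt hx
    exact (h2.comp_hasDerivAt 0 h1).deriv

theorem fderiv_of_mem (hr : IsRetractionOn Q U r) {x : E} (hx : x ∈ U)
    {v : E} (hv : v ∈ tangentSpaceAt Q x) : fderiv ℝ r x v = v := by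
  unfold tangentSpaceAt at hv
  induction hv using Submodule.span_induction with
  | mem v hv =>
    obtain ⟨γ, hγ, h0, hQ, rfl⟩ := hv
    have hγ' := (hγ.differentiableAt (by simp)).hasDerivAt
    have hr' : HasFDerivAt r (fderiv ℝ r x) (γ 0) := by
      rw [h0]
      exact hr.hasFDerivAt hx
    have h1 := hr'.comp_hasDerivAt 0 hγ'
    have h2 : r ∘ γ =ᶠ[𝓝 0] γ := by
      have : ∀ᶠ t in 𝓝 (0 : ℝ), γ t ∈ U :=
        hγ.continuousAt.eventually_mem (by rw [h0]; exact hr.isOpen.mem_nhds hx)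
      filter_upwards [this, hQ] with t h3 h4 using hr.eq_self _ h4 h3
    exact h1.unique (hγ'.congr_of_eventuallyEq h2)
  | zero => simp
  | add v w _ _ hv hw => rw [map_add, hv, hw]
  | smul c v _ hv => rw [map_smul, hv]

end IsRetractionOn

/-! ### Derivatives along tangent vectors and curvature -/

namespace IsLocalRetract

variable {Q : Set E} {x ξ : E}

/-- Along tangent vectors `fderivWithin` is given by any derivative within `Q`, although `Q` is not
a set of unique differentiability. -/
theorem fderivWithin_apply (hQ : IsLocalRetract Q) (hx : x ∈ Q) (hξ : ξ ∈ tangentSpaceAt Q x)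
    {f : E → G} {f' : E →L[ℝ] G} (hf : HasFDerivWithinAt f f' Q x) :
    fderivWithin ℝ f Q x ξ = f' ξ := by
  obtain ⟨U, r, hxU, hr⟩ := hQ x hx
  have h1 := hr.hasFDerivAt_comp hx hxU hf
  have h2 := hr.hasFDerivAt_comp hx hxU hf.differentiableWithinAt.hasFDerivWithinAt
  have h3 := congrArg (fun T : E →L[ℝ] G => T ξ) (h2.unique h1)
  simpa [hr.fderiv_of_mem hxU hξ] using h3

theorem fderivWithin_eq_fderiv_comp {U : Set E} {r : E → E} (hr : IsRetractionOn Q U r)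
    (hx : x ∈ Q) (hxU : x ∈ U) (hξ : ξ ∈ tangentSpaceAt Q x)
    {f : E → G} (hf : DifferentiableWithinAt ℝ f Q x) :
    fderivWithin ℝ f Q x ξ = fderiv ℝ (f ∘ r) x ξ := by
  rw [(hr.hasFDerivAt_comp hx hxU hf.hasFDerivWithinAt).fderiv]
  simp [hr.fderiv_of_mem hxU hξ]

theorem contDiffOn_of_local (hQ : IsLocalRetract Q) {f : E → G}
    (h : ∀ (U : Set E) (r : E → E), IsRetractionOn Q U r → ContDiffOn ℝ ∞ f (Q ∩ U)) :
    ContDiffOn ℝ ∞ f Q := by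
  refine contDiffOn_of_locally_contDiffOn fun x hx => ?_
  obtain ⟨U, r, hxU, hr⟩ := hQ x hx
  exact ⟨U, hr.isOpen, hxU, h U r hr⟩

/-- The derivative of a smooth function on `Q`, precomposed with a smooth family of operators with
values in the tangent spaces, is smooth. -/
theorem contDiffOn_fderivWithin_comp (hQ : IsLocalRetract Q) {f : E → G}
    (hf : ContDiffOn ℝ ∞ f Q) {P : E → G' →L[ℝ] E} (hP : ContDiffOn ℝ ∞ P Q)
    (hPT : ∀ x ∈ Q, ∀ v, P x v ∈ tangentSpaceAt Q x) :
    ContDiffOn ℝ ∞ (fun x => fderivWithin ℝ f Q x ∘L P x) Q := by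
  refine hQ.contDiffOn_of_local fun U r hr => ?_
  have h1 : ContDiffOn ℝ ∞ (fderiv ℝ (f ∘ r)) U :=
    (hr.contDiffOn_comp hf).fderiv_of_isOpen hr.isOpen (by simp)
  refine ((h1.mono inter_subset_right).clm_comp (hP.mono inter_subset_left)).congr ?_
  rintro x ⟨hx, hxU⟩
  ext v
  exact fderivWithin_eq_fderiv_comp hr hx hxU (hPT x hx v)
    ((hf x hx).differentiableWithinAt (by simp))

theorem contDiffOn_fderivWithin_apply (hQ : IsLocalRetract Q) {f : E → G}
    (hf : ContDiffOn ℝ ∞ f Q) {X : E → E} (hX : ContDiffOn ℝ ∞ X Q)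
    (hXT : ∀ x ∈ Q, X x ∈ tangentSpaceAt Q x) :
    ContDiffOn ℝ ∞ (fun x => fderivWithin ℝ f Q x (X x)) Q := by
  refine hQ.contDiffOn_of_local fun U r hr => ?_
  have h1 : ContDiffOn ℝ ∞ (fderiv ℝ (f ∘ r)) U :=
    (hr.contDiffOn_comp hf).fderiv_of_isOpen hr.isOpen (by simp)
  refine ((h1.mono inter_subset_right).clm_apply (hX.mono inter_subset_left)).congr ?_
  rintro x ⟨hx, hxU⟩
  exact fderivWithin_eq_fderiv_comp hr hx hxU (hXT x hx)
    ((hf x hx).differentiableWithinAt (by simp))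

/-- `D_X D_Y f - D_Y D_X f` is the derivative of an extension of `f` along the bracket: the second
derivative of the extension is symmetric. -/
theorem fderivWithin_commutator_aux {U : Set E} {r : E → E} (hQ : IsLocalRetract Q)
    (hr : IsRetractionOn Q U r) (hx : x ∈ Q) (hxU : x ∈ U) {f : E → G} (hf : ContDiffOn ℝ ∞ f Q)
    {X Y : E → E} (hX : IsVectorField Q X) (hY : IsVectorField Q Y) :
    fderivWithin ℝ (fun y => fderivWithin ℝ f Q y (Y y)) Q x (X x)
      - fderivWithin ℝ (fun y => fderivWithin ℝ f Q y (X y)) Q x (Y x)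
      = fderiv ℝ (f ∘ r) x (VectorField.lieBracketWithin ℝ X Y Q x) := by
  have hfr : ContDiffAt ℝ ∞ (f ∘ r) x := (hr.contDiffOn_comp hf).contDiffAt (hr.isOpen.mem_nhds hxU)
  have hd : HasFDerivAt (fderiv ℝ (f ∘ r)) (fderiv ℝ (fderiv ℝ (f ∘ r)) x) x :=
    ((hfr.fderiv_right (m := 1) (by norm_cast)).differentiableAt (by simp)).hasFDerivAt
  have key : ∀ {X Y : E → E}, IsVectorField Q X → IsVectorField Q Y →
      fderivWithin ℝ (fun y => fderivWithin ℝ f Q y (Y y)) Q x (X x)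
        = fderiv ℝ (fderiv ℝ (f ∘ r)) x (X x) (Y x)
          + fderiv ℝ (f ∘ r) x (fderivWithin ℝ Y Q x (X x)) := by
    intro X Y hX hY
    have hYd := ((hY.1 x hx).differentiableWithinAt (by simp)).hasFDerivWithinAt
    have h1 := hd.hasFDerivWithinAt.clm_apply hYd
    have h2 : (fun y => fderivWithin ℝ f Q y (Y y)) =ᶠ[𝓝[Q] x]
        fun y => fderiv ℝ (f ∘ r) y (Y y) := by
      filter_upwards [self_mem_nhdsWithin, mem_nhdsWithin_of_mem_nhds (hr.isOpen.mem_nhds hxU)]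
        with y hy hyU
      exact fderivWithin_eq_fderiv_comp hr hy hyU (hY.2 y hy)
        ((hf y hy).differentiableWithinAt (by simp))
    rw [hQ.fderivWithin_apply hx (hX.2 x hx)
      (h1.congr_of_eventuallyEq h2 (h2.self_of_nhdsWithin hx))]
    simp [add_comm]
  rw [key hX hY, key hY hX, VectorField.lieBracketWithin, map_sub,
    (hfr.isSymmSndFDerivAt (by simpa using ENat.LEInfty.out)).eq (X x) (Y x)]
  abel

theorem lieBracketWithin_mem (hQ : IsLocalRetract Q) (hx : x ∈ Q)
    {X Y : E → E} (hX : IsVectorField Q X) (hY : IsVectorField Q Y) :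
    VectorField.lieBracketWithin ℝ X Y Q x ∈ tangentSpaceAt Q x := by
  obtain ⟨U, r, hxU, hr⟩ := hQ x hx
  have h := fderivWithin_commutator_aux (f := id) hQ hr hx hxU contDiffOn_id hX hY
  have key : ∀ {X Y : E → E}, IsVectorField Q X → IsVectorField Q Y →
      fderivWithin ℝ (fun y => fderivWithin ℝ id Q y (Y y)) Q x (X x)
        = fderivWithin ℝ Y Q x (X x) := by
    intro X Y hX hY
    have h1 : Set.EqOn (fun y => fderivWithin ℝ id Q y (Y y)) Y Q := fun y hy =>
      hQ.fderivWithin_apply hy (hY.2 y hy) (hasFDerivWithinAt_id y Q)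
    rw [fderivWithin_congr h1 (h1 hx)]
  rw [key hX hY, key hY hX] at h
  have h' : VectorField.lieBracketWithin ℝ X Y Q x
      = fderiv ℝ r x (VectorField.lieBracketWithin ℝ X Y Q x) := h
  rw [h']
  exact hr.fderiv_mem hx hxU _

theorem fderivWithin_commutator (hQ : IsLocalRetract Q) (hx : x ∈ Q) {f : E → G}
    (hf : ContDiffOn ℝ ∞ f Q) {X Y : E → E} (hX : IsVectorField Q X) (hY : IsVectorField Q Y) :
    fderivWithin ℝ (fun y => fderivWithin ℝ f Q y (Y y)) Q x (X x)
      - fderivWithin ℝ (fun y => fderivWithin ℝ f Q y (X y)) Q x (Y x)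
      = fderivWithin ℝ f Q x (VectorField.lieBracketWithin ℝ X Y Q x) := by
  obtain ⟨U, r, hxU, hr⟩ := hQ x hx
  rw [fderivWithin_commutator_aux hQ hr hx hxU hf hX hY,
    fderivWithin_eq_fderiv_comp hr hx hxU (hQ.lieBracketWithin_mem hx hX hY)
      ((hf x hx).differentiableWithinAt (by simp))]

/-- For any smooth bilinear `Γ`, the curvature of `D + Γ` is a tensor given by `Γ` and its
derivative. No bundle need be preserved by `D + Γ`. -/
theorem curvature_covDeriv (hQ : IsLocalRetract Q) (hx : x ∈ Q) {Γ : E → E →L[ℝ] E →L[ℝ] E}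
    (hΓ : ContDiffOn ℝ ∞ Γ Q) {X Y Z : E → E} (hX : IsVectorField Q X) (hY : IsVectorField Q Y)
    (hZ : ContDiffOn ℝ ∞ Z Q) :
    curvature Q (covDeriv Q Γ) X Y Z x = christoffelCurvature Q Γ x (X x) (Y x) (Z x) := by
  have hdiff : ∀ {G : Type _} [NormedAddCommGroup G] [NormedSpace ℝ G] {f : E → G},
      ContDiffOn ℝ ∞ f Q → HasFDerivWithinAt f (fderivWithin ℝ f Q x) Q x := fun hf =>
    ((hf x hx).differentiableWithinAt (by simp)).hasFDerivWithinAt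
  have key : ∀ {X Y : E → E}, IsVectorField Q X → IsVectorField Q Y →
      fderivWithin ℝ (covDeriv Q Γ Y Z) Q x (X x)
        = fderivWithin ℝ (fun y => fderivWithin ℝ Z Q y (Y y)) Q x (X x)
          + (fderivWithin ℝ Γ Q x (X x) (Y x) (Z x) + Γ x (fderivWithin ℝ Y Q x (X x)) (Z x)
            + Γ x (Y x) (fderivWithin ℝ Z Q x (X x))) := by
    intro X Y hX hY
    have h1 := (hdiff (hQ.contDiffOn_fderivWithin_apply hZ hY.1 hY.2)).add
      (((hdiff hΓ).clm_apply (hdiff hY.1)).clm_apply (hdiff hZ))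
    exact (hQ.fderivWithin_apply hx (hX.2 x hx) h1).trans (by simp; abel)
  have hcomm := hQ.fderivWithin_commutator hx hZ hX hY
  simp only [curvature, christoffelCurvature]
  simp only [covDeriv, covDerivAt] at key ⊢
  rw [key hX hY, key hY hX, ← hcomm]
  simp only [VectorField.lieBracketWithin, map_add, map_sub, sub_apply]
  abel

end IsLocalRetract

end Calculus

/-! ### Metric projections and smooth right inverses -/

section Projection

variable {E : Type*} [NormedAddCommGroup E] [InnerProductSpace ℝ E]

/-- A smooth family of operators that is surjective at `q` has a smooth family of right inverses
near `q`. -/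
theorem exists_local_rightInverse {F : Type*} [NormedAddCommGroup F] [NormedSpace ℝ F]
    [FiniteDimensional ℝ F] {Q : Set E} {D : E → E →L[ℝ] F} (hD : ContDiffOn ℝ ∞ D Q)
    {q : E} (hq : q ∈ Q) (hsurj : Function.Surjective (D q)) :
    ∃ (U : Set E) (M : E → F →L[ℝ] E), IsOpen U ∧ q ∈ U ∧ ContDiffOn ℝ ∞ M (Q ∩ U) ∧
      ∀ x ∈ Q, x ∈ U → ∀ u, D x (M x u) = u := by
  obtain ⟨S, hS⟩ := (D q : E →ₗ[ℝ] F).exists_rightInverse_of_surjective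
    (LinearMap.range_eq_top.2 hsurj)
  have : CompleteSpace F := FiniteDimensional.complete ℝ F
  have hS' : ContDiffOn ℝ ∞ (fun x => D x ∘L S.toContinuousLinearMap) Q :=
    hD.clm_comp contDiffOn_const
  obtain ⟨U, hU, hUeq⟩ := continuousOn_iff'.1 hS'.continuousOn _
    (ContinuousLinearEquiv.isOpen (𝕜 := ℝ) (E := F) (F := F))
  have hinv : ∀ x ∈ Q, x ∈ U → (D x ∘L S.toContinuousLinearMap).IsInvertible := fun x hx hxU =>
    (hUeq.symm.subset ⟨hxU, hx⟩).1
  refine ⟨U, fun x => S.toContinuousLinearMap ∘L (D x ∘L S.toContinuousLinearMap).inverse, hU, ?_,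
    ?_, ?_⟩
  · refine (hUeq.subset ⟨?_, hq⟩).1
    refine ⟨ContinuousLinearEquiv.refl ℝ F, ?_⟩
    ext u
    exact (LinearMap.congr_fun hS u).symm
  · refine contDiffOn_const.clm_comp fun x hx => ?_
    exact (hinv x hx.1 hx.2).contDiffAt_map_inverse.comp_contDiffWithinAt x
      ((hS' x hx.1).mono inter_subset_left)
  · intro x hx hxU u
    exact (hinv x hx hxU).self_apply_inverse u

/-- The pairing `⟨v, G w⟩` is nondegenerate on `W`. -/
def IsNondegenerateOn (G : E →L[ℝ] E) (W : Submodule ℝ E) : Prop :=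
  ∀ v ∈ W, (∀ w ∈ W, inner ℝ v (G w) = 0) → v = 0

theorem isInvertible_of_ker_eq_zero {E' : Type*} [NormedAddCommGroup E'] [NormedSpace ℝ E']
    [FiniteDimensional ℝ E'] {T : E' →L[ℝ] E'} (hT : ∀ v, T v = 0 → v = 0) : T.IsInvertible := by
  have hinj : Function.Injective (T : E' →ₗ[ℝ] E') :=
    (injective_iff_map_eq_zero (T : E' →ₗ[ℝ] E')).2 hT
  refine ⟨(LinearEquiv.ofInjectiveEndo _ hinj).toContinuousLinearEquiv, ?_⟩
  ext v
  rfl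

variable [FiniteDimensional ℝ E]

theorem metricProjection_mem (G : E →L[ℝ] E) (W : Submodule ℝ E) (v : E) :
    metricProjection G W v ∈ W := by
  simp only [metricProjection, ContinuousLinearMap.comp_apply, Submodule.subtypeL_apply]
  exact Subtype.prop _

theorem inner_metricProjection {G : E →L[ℝ] E} {W : Submodule ℝ E}
    (hsymm : ∀ v w : E, inner ℝ (G v) w = inner ℝ v (G w)) (hG : IsNondegenerateOn G W)
    {w : E} (hw : w ∈ W) (v : E) :
    inner ℝ w (G (metricProjection G W v)) = inner ℝ w (G v) := by
  obtain ⟨T, hT⟩ : ∃ T : W →L[ℝ] W, T = W.subtypeL.adjoint ∘L G ∘L W.subtypeL := ⟨_, rfl⟩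
  have hP : metricProjection G W v = (T.inverse (W.subtypeL.adjoint (G v)) : E) := by
    rw [hT]
    rfl
  have hTi : ∀ a b : W, inner ℝ a (T b) = inner ℝ (a : E) (G b) := by
    intro a b
    rw [hT, ContinuousLinearMap.comp_apply, ContinuousLinearMap.adjoint_inner_right]
    rfl
  have hinv : T.IsInvertible := by
    refine isInvertible_of_ker_eq_zero fun a ha => Subtype.ext (hG a a.2 fun b hb => ?_)
    rw [← hsymm, real_inner_comm, ← hTi ⟨b, hb⟩ a, ha, inner_zero_right]
  rw [hP, ← hTi ⟨w, hw⟩, hinv.self_apply_inverse, ContinuousLinearMap.adjoint_inner_right]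
  rfl

/-- The metric projection of `v` is the only vector of `W` that has the same pairings with `W`
as `v`. -/
theorem metricProjection_eq {G : E →L[ℝ] E} {W : Submodule ℝ E}
    (hsymm : ∀ v w : E, inner ℝ (G v) w = inner ℝ v (G w)) (hG : IsNondegenerateOn G W)
    {v y : E} (hy : y ∈ W) (h : ∀ w ∈ W, inner ℝ w (G y) = inner ℝ w (G v)) :
    metricProjection G W v = y := by
  refine sub_eq_zero.1 (hG _ (sub_mem (metricProjection_mem G W v) hy) fun w hw => ?_)
  rw [← hsymm, real_inner_comm, map_sub, inner_sub_right,
    inner_metricProjection hsymm hG hw, h w hw, sub_self]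

theorem metricProjection_eq_self {G : E →L[ℝ] E} {W : Submodule ℝ E}
    (hsymm : ∀ v w : E, inner ℝ (G v) w = inner ℝ v (G w)) (hG : IsNondegenerateOn G W)
    {v : E} (hv : v ∈ W) : metricProjection G W v = v :=
  metricProjection_eq hsymm hG hv fun _ _ => rfl

theorem inner_metricProjection_comm {G : E →L[ℝ] E} {W : Submodule ℝ E}
    (hsymm : ∀ v w : E, inner ℝ (G v) w = inner ℝ v (G w)) (hG : IsNondegenerateOn G W) (v w : E) :
    inner ℝ (metricProjection G W v) (G w) = inner ℝ v (G (metricProjection G W w)) := by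
  rw [← inner_metricProjection hsymm hG (metricProjection_mem G W v) w, ← hsymm, real_inner_comm,
    inner_metricProjection hsymm hG (metricProjection_mem G W w), ← hsymm, real_inner_comm]

theorem contDiff_adjoint : ContDiff ℝ ∞ (fun A : E →L[ℝ] E => A.adjoint) := by
  have h : IsBoundedLinearMap ℝ (fun A : E →L[ℝ] E => A.adjoint) :=
    IsLinearMap.with_bound ⟨fun A B => map_add _ A B, fun c A => by simp⟩ 1
      fun A => by simp
  exact h.contDiff

/-- A nondegenerate family of subspaces that is the range of a smooth family of projections, not
necessarily self-adjoint, has a smooth metric projection. If `N` projects onto `W`, then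
`Nᵗ G N + (1 - N)ᵗ (1 - N)` is invertible, and the metric projection is
`N (Nᵗ G N + (1 - N)ᵗ (1 - N))⁻¹ Nᵗ G`. -/
theorem contDiffOn_metricProjection {S : Set E} {g N : E → E →L[ℝ] E} {W : E → Submodule ℝ E}
    (hg : ContDiffOn ℝ ∞ g S) (hN : ContDiffOn ℝ ∞ N S)
    (hsymm : ∀ x ∈ S, ∀ v w : E, inner ℝ (g x v) w = inner ℝ v (g x w))
    (hnd : ∀ x ∈ S, IsNondegenerateOn (g x) (W x)) (hmem : ∀ x ∈ S, ∀ v, N x v ∈ W x)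
    (hid : ∀ x ∈ S, ∀ v ∈ W x, N x v = v) :
    ContDiffOn ℝ ∞ (fun x => metricProjection (g x) (W x)) S := by
  let K : E → E →L[ℝ] E := fun x => (N x).adjoint ∘L g x ∘L N x +
    (ContinuousLinearMap.id ℝ E - N x).adjoint ∘L (ContinuousLinearMap.id ℝ E - N x)
  have hNadj : ContDiffOn ℝ ∞ (fun x => (N x).adjoint) S := contDiff_adjoint.comp_contDiffOn hN
  have hN' : ContDiffOn ℝ ∞ (fun x => ContinuousLinearMap.id ℝ E - N x) S := contDiffOn_const.sub hN
  have hK : ContDiffOn ℝ ∞ K S :=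
    (hNadj.clm_comp (hg.clm_comp hN)).add ((contDiff_adjoint.comp_contDiffOn hN').clm_comp hN')
  have hKinner : ∀ x (v w : E), inner ℝ w (K x v) =
      inner ℝ (N x w) (g x (N x v)) + inner ℝ (w - N x w) (v - N x v) := by
    intro x v w
    simp only [K, add_apply, inner_add_right, ContinuousLinearMap.comp_apply,
      ContinuousLinearMap.adjoint_inner_right, sub_apply, ContinuousLinearMap.id_apply]
  have hNN : ∀ x ∈ S, ∀ v, N x (N x v) = N x v := fun x hx v => hid x hx _ (hmem x hx v)
  have hKinv : ∀ x ∈ S, (K x).IsInvertible := by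
    intro x hx
    refine isInvertible_of_ker_eq_zero fun v hv => ?_
    have h1 : N x v = 0 := by
      refine hnd x hx _ (hmem x hx v) fun w hw => ?_
      have := hKinner x v w
      rw [hv, hid x hx w hw] at this
      rw [← hsymm x hx, real_inner_comm]
      simpa using this.symm
    have h2 := hKinner x v v
    rw [hv, h1] at h2
    simpa using h2.symm
  have hKi : ContDiffOn ℝ ∞ (fun x => (K x).inverse) S := fun x hx =>
    (hKinv x hx).contDiffAt_map_inverse.comp_contDiffWithinAt x (hK x hx)
  refine (hN.clm_comp (hKi.clm_comp (hNadj.clm_comp hg))).congr fun x hx => ?_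
  ext v
  refine metricProjection_eq (hsymm x hx) (hnd x hx) (hmem x hx _) fun w hw => ?_
  have h1 := hKinner x ((K x).inverse ((N x).adjoint (g x v))) w
  rw [(hKinv x hx).self_apply_inverse, ContinuousLinearMap.adjoint_inner_right, hid x hx w hw,
    sub_self, inner_zero_left, add_zero] at h1
  exact h1.symm

end Projection

/-! ### Splittings of the tangent bundle -/

section Splitting

variable {E : Type*} [NormedAddCommGroup E] [InnerProductSpace ℝ E]

/-- The tangent bundle of `Q` is split into the ranges of two complementary smooth families of
projections `H`, `V` of `E` that are self-adjoint for the pairings `⟨v, g x w⟩`. These pairings are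
symmetric and, as `eq_zero` says, nondegenerate on all of `E`. -/
structure IsSplitting (Q : Set E) (g H V : E → E →L[ℝ] E) : Prop where
  contDiffOn_g : ContDiffOn ℝ ∞ g Q
  contDiffOn_H : ContDiffOn ℝ ∞ H Q
  contDiffOn_V : ContDiffOn ℝ ∞ V Q
  g_symm : ∀ x ∈ Q, ∀ v w : E, inner ℝ (g x v) w = inner ℝ v (g x w)
  eq_zero : ∀ x ∈ Q, ∀ v : E, (∀ w, inner ℝ v (g x w) = 0) → v = 0
  H_mem : ∀ x ∈ Q, ∀ v, H x v ∈ tangentSpaceAt Q x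
  V_mem : ∀ x ∈ Q, ∀ v, V x v ∈ tangentSpaceAt Q x
  add_eq : ∀ x ∈ Q, ∀ v ∈ tangentSpaceAt Q x, H x v + V x v = v
  H_H : ∀ x ∈ Q, ∀ v, H x (H x v) = H x v
  H_V : ∀ x ∈ Q, ∀ v, H x (V x v) = 0
  V_H : ∀ x ∈ Q, ∀ v, V x (H x v) = 0
  V_V : ∀ x ∈ Q, ∀ v, V x (V x v) = V x v
  H_symm : ∀ x ∈ Q, ∀ v w : E, inner ℝ (H x v) (g x w) = inner ℝ v (g x (H x w))
  V_symm : ∀ x ∈ Q, ∀ v w : E, inner ℝ (V x v) (g x w) = inner ℝ v (g x (V x w))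

/-- The pointwise content of the Levi-Civita property of `D + Γ`: on tangent vectors `Γ` is
symmetric, and it is compatible with the derivative of `g`. Unlike the connection itself, this
restricts to relatively open subsets of `Q`. -/
structure IsMetricChristoffel (Q : Set E) (g : E → E →L[ℝ] E) (Γ : E → E →L[ℝ] E →L[ℝ] E) :
    Prop where
  contDiffOn : ContDiffOn ℝ ∞ Γ Q
  symm : ∀ x ∈ Q, ∀ ξ ∈ tangentSpaceAt Q x, ∀ η ∈ tangentSpaceAt Q x, Γ x ξ η = Γ x η ξ
  metric : ∀ x ∈ Q, ∀ ξ ∈ tangentSpaceAt Q x, ∀ η ∈ tangentSpaceAt Q x,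
    ∀ ζ ∈ tangentSpaceAt Q x, inner ℝ η (fderivWithin ℝ g Q x ξ ζ) =
      inner ℝ (Γ x ξ η) (g x ζ) + inner ℝ η (g x (Γ x ξ ζ))

/-- The value of `V ∇_ξ (H v)` at `x`, for `v` a fixed vector of `E`: the tensor `A` of the
splitting, in terms of the derivative of `H`. -/
noncomputable def splitA (Q : Set E) (H V : E → E →L[ℝ] E) (Γ : E → E →L[ℝ] E →L[ℝ] E)
    (x ξ v : E) : E :=
  V x (fderivWithin ℝ H Q x ξ v + Γ x ξ (H x v))

/-- The value of `- H ∇_ξ (V v)` at `x`, for `v` a fixed vector of `E`: the tensor `A†` of the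
splitting, in terms of the derivative of `V`. -/
noncomputable def splitAdag (Q : Set E) (H V : E → E →L[ℝ] E) (Γ : E → E →L[ℝ] E →L[ℝ] E)
    (x ξ v : E) : E :=
  - H x (fderivWithin ℝ V Q x ξ v + Γ x ξ (V x v))

/-- `ΓH` has the values on (tangent, horizontal) pairs that a Christoffel function of the
connection `H ∇` on the horizontal bundle must have. Being pointwise, this restricts to relatively
open subsets of `Q`. -/
def IsHorizontalChristoffel (Q : Set E) (H : E → E →L[ℝ] E) (Γ ΓH : E → E →L[ℝ] E →L[ℝ] E) :
    Prop :=
  ∀ x ∈ Q, ∀ ξ ∈ tangentSpaceAt Q x, ∀ v,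
    ΓH x ξ (H x v) = H x (Γ x ξ (H x v)) - fderivWithin ℝ H Q x ξ (H x v)

variable {Q : Set E} {g H V : E → E →L[ℝ] E} {Γ ΓH : E → E →L[ℝ] E →L[ℝ] E} {x ξ η : E}

theorem differentiableWithinAt_of_contDiffOn {G : Type*} [NormedAddCommGroup G] [NormedSpace ℝ G]
    {f : E → G} (hf : ContDiffOn ℝ ∞ f Q) (hx : x ∈ Q) : DifferentiableWithinAt ℝ f Q x :=
  (hf x hx).differentiableWithinAt (by simp)

theorem covDerivAt_congr {s t : E → E} (h : ∀ y ∈ Q, s y = t y) (hx : x ∈ Q) :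
    covDerivAt Q Γ x ξ s = covDerivAt Q Γ x ξ t := by
  rw [covDerivAt, covDerivAt, fderivWithin_congr h (h x hx), h x hx]

theorem contDiffOn_covDeriv (hQ : IsLocalRetract Q) (hΓ : ContDiffOn ℝ ∞ Γ Q) {X s : E → E}
    (hX : IsVectorField Q X) (hs : ContDiffOn ℝ ∞ s Q) : ContDiffOn ℝ ∞ (covDeriv Q Γ X s) Q :=
  (hQ.contDiffOn_fderivWithin_apply hs hX.1 hX.2).add ((hΓ.clm_apply hX.1).clm_apply hs)

theorem IsLocalRetract.fderivWithin_clm_apply (hQ : IsLocalRetract Q) (hx : x ∈ Q)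
    (hξ : ξ ∈ tangentSpaceAt Q x) {G G' : Type*} [NormedAddCommGroup G] [NormedSpace ℝ G]
    [NormedAddCommGroup G'] [NormedSpace ℝ G'] {P : E → G →L[ℝ] G'} {s : E → G}
    (hP : DifferentiableWithinAt ℝ P Q x) (hs : DifferentiableWithinAt ℝ s Q x) :
    fderivWithin ℝ (fun y => P y (s y)) Q x ξ
      = fderivWithin ℝ P Q x ξ (s x) + P x (fderivWithin ℝ s Q x ξ) := by
  rw [hQ.fderivWithin_apply hx hξ (hP.hasFDerivWithinAt.clm_apply hs.hasFDerivWithinAt)]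
  simp [add_comm]

theorem fderivWithin_clm_const_apply (hQ : IsLocalRetract Q) (hx : x ∈ Q)
    (hξ : ξ ∈ tangentSpaceAt Q x) {G G' : Type*} [NormedAddCommGroup G] [NormedSpace ℝ G]
    [NormedAddCommGroup G'] [NormedSpace ℝ G'] {P : E → G →L[ℝ] G'}
    (hP : DifferentiableWithinAt ℝ P Q x) (v : G) :
    fderivWithin ℝ (fun y => P y v) Q x ξ = fderivWithin ℝ P Q x ξ v := by
  rw [hQ.fderivWithin_clm_apply hx hξ hP (differentiableWithinAt_const v)]
  simp

theorem covDerivAt_clm_apply (hQ : IsLocalRetract Q) (hx : x ∈ Q)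
    (hξ : ξ ∈ tangentSpaceAt Q x) {G : Type*} [NormedAddCommGroup G] [NormedSpace ℝ G]
    {P : E → G →L[ℝ] E} {s : E → G}
    (hP : DifferentiableWithinAt ℝ P Q x) (hs : DifferentiableWithinAt ℝ s Q x) :
    covDerivAt Q Γ x ξ (fun y => P y (s y))
      = fderivWithin ℝ P Q x ξ (s x) + P x (fderivWithin ℝ s Q x ξ) + Γ x ξ (P x (s x)) := by
  rw [covDerivAt, hQ.fderivWithin_clm_apply hx hξ hP hs]

theorem covDerivAt_clm_const_apply (hQ : IsLocalRetract Q) (hx : x ∈ Q)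
    (hξ : ξ ∈ tangentSpaceAt Q x) {G : Type*} [NormedAddCommGroup G] [NormedSpace ℝ G]
    {P : E → G →L[ℝ] E} (hP : DifferentiableWithinAt ℝ P Q x) (v : G) :
    covDerivAt Q Γ x ξ (fun y => P y v) = fderivWithin ℝ P Q x ξ v + Γ x ξ (P x v) := by
  rw [covDerivAt, fderivWithin_clm_const_apply hQ hx hξ hP]

/-- The Leibniz rule for an identity `P R = S` between operators. -/
theorem fderivWithin_operator_mul (hQ : IsLocalRetract Q) (hx : x ∈ Q)
    (hξ : ξ ∈ tangentSpaceAt Q x) {P R S : E → E →L[ℝ] E} (hP : ContDiffOn ℝ ∞ P Q)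
    (hR : ContDiffOn ℝ ∞ R Q) (hS : ContDiffOn ℝ ∞ S Q)
    (h : ∀ y ∈ Q, ∀ v, P y (R y v) = S y v) (v : E) :
    fderivWithin ℝ P Q x ξ (R x v) + P x (fderivWithin ℝ R Q x ξ v) =
      fderivWithin ℝ S Q x ξ v := by
  have hR' := differentiableWithinAt_of_contDiffOn hR hx
  rw [← fderivWithin_clm_const_apply hQ hx hξ hR',
    ← hQ.fderivWithin_clm_apply hx hξ (differentiableWithinAt_of_contDiffOn hP hx)
      (hR'.clm_apply (differentiableWithinAt_const v)),
    ← fderivWithin_clm_const_apply hQ hx hξ (differentiableWithinAt_of_contDiffOn hS hx),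
    fderivWithin_congr (fun y hy => h y hy v) (h x hx v)]

namespace IsSplitting

theorem diff_H (hS : IsSplitting Q g H V) (hx : x ∈ Q) : DifferentiableWithinAt ℝ H Q x :=
  differentiableWithinAt_of_contDiffOn hS.contDiffOn_H hx

theorem diff_V (hS : IsSplitting Q g H V) (hx : x ∈ Q) : DifferentiableWithinAt ℝ V Q x :=
  differentiableWithinAt_of_contDiffOn hS.contDiffOn_V hx

theorem isVectorField_V (hS : IsSplitting Q g H V) (v : E) : IsVectorField Q (fun y => V y v) :=
  ⟨hS.contDiffOn_V.clm_apply contDiffOn_const, fun y hy => hS.V_mem y hy v⟩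

theorem isVectorField_H (hS : IsSplitting Q g H V) (v : E) : IsVectorField Q (fun y => H y v) :=
  ⟨hS.contDiffOn_H.clm_apply contDiffOn_const, fun y hy => hS.H_mem y hy v⟩

theorem H_fderivWithin_H (hS : IsSplitting Q g H V) (hQ : IsLocalRetract Q) (hx : x ∈ Q)
    (hξ : ξ ∈ tangentSpaceAt Q x) (v : E) :
    fderivWithin ℝ H Q x ξ (H x v) + H x (fderivWithin ℝ H Q x ξ v) = fderivWithin ℝ H Q x ξ v :=
  fderivWithin_operator_mul hQ hx hξ hS.contDiffOn_H hS.contDiffOn_H hS.contDiffOn_H hS.H_H v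

theorem H_fderivWithin_H_H (hS : IsSplitting Q g H V) (hQ : IsLocalRetract Q) (hx : x ∈ Q)
    (hξ : ξ ∈ tangentSpaceAt Q x) (v : E) : H x (fderivWithin ℝ H Q x ξ (H x v)) = 0 := by
  have := hS.H_fderivWithin_H hQ hx hξ (H x v)
  rw [hS.H_H x hx] at this
  exact left_eq_add.1 this.symm

theorem V_fderivWithin_H (hS : IsSplitting Q g H V) (hQ : IsLocalRetract Q) (hx : x ∈ Q)
    (hξ : ξ ∈ tangentSpaceAt Q x) (v : E) :
    V x (fderivWithin ℝ H Q x ξ v) = - fderivWithin ℝ V Q x ξ (H x v) := by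
  have := fderivWithin_operator_mul (S := fun _ => 0) hQ hx hξ hS.contDiffOn_V hS.contDiffOn_H
    contDiffOn_const hS.V_H v
  rw [fderivWithin_fun_const] at this
  exact eq_neg_of_add_eq_zero_right this

theorem H_fderivWithin_V (hS : IsSplitting Q g H V) (hQ : IsLocalRetract Q) (hx : x ∈ Q)
    (hξ : ξ ∈ tangentSpaceAt Q x) (v : E) :
    H x (fderivWithin ℝ V Q x ξ v) = - fderivWithin ℝ H Q x ξ (V x v) := by
  have := fderivWithin_operator_mul (S := fun _ => 0) hQ hx hξ hS.contDiffOn_H hS.contDiffOn_V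
    contDiffOn_const hS.H_V v
  rw [fderivWithin_fun_const] at this
  exact eq_neg_of_add_eq_zero_right this

theorem splitA_eq (hS : IsSplitting Q g H V) (hQ : IsLocalRetract Q) (hx : x ∈ Q)
    (hξ : ξ ∈ tangentSpaceAt Q x) (v : E) :
    splitA Q H V Γ x ξ v = - fderivWithin ℝ V Q x ξ (H x v) + V x (Γ x ξ (H x v)) := by
  rw [splitA, map_add, hS.V_fderivWithin_H hQ hx hξ]

theorem splitAdag_eq (hS : IsSplitting Q g H V) (hQ : IsLocalRetract Q) (hx : x ∈ Q)
    (hξ : ξ ∈ tangentSpaceAt Q x) (v : E) :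
    splitAdag Q H V Γ x ξ v = fderivWithin ℝ H Q x ξ (V x v) - H x (Γ x ξ (V x v)) := by
  rw [splitAdag, map_add, hS.H_fderivWithin_V hQ hx hξ]
  abel

theorem splitAdag_V (hS : IsSplitting Q g H V) (hQ : IsLocalRetract Q) (hx : x ∈ Q)
    (hξ : ξ ∈ tangentSpaceAt Q x) (v : E) :
    splitAdag Q H V Γ x ξ (V x v) = splitAdag Q H V Γ x ξ v := by
  rw [hS.splitAdag_eq hQ hx hξ, hS.splitAdag_eq hQ hx hξ, hS.V_V x hx]

/-- `V ∇_ξ` of a horizontal field depends only on the value of the field. -/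
theorem V_covDerivAt_H (hS : IsSplitting Q g H V) (hQ : IsLocalRetract Q) (hx : x ∈ Q)
    (hξ : ξ ∈ tangentSpaceAt Q x) {s : E → E} (hs : DifferentiableWithinAt ℝ s Q x) :
    V x (covDerivAt Q Γ x ξ (fun y => H y (s y))) = splitA Q H V Γ x ξ (s x) := by
  rw [covDerivAt_clm_apply hQ hx hξ (hS.diff_H hx) hs, map_add, map_add, hS.V_H x hx, splitA,
    map_add, add_zero]

theorem H_covDerivAt_V (hS : IsSplitting Q g H V) (hQ : IsLocalRetract Q) (hx : x ∈ Q)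
    (hξ : ξ ∈ tangentSpaceAt Q x) {s : E → E} (hs : DifferentiableWithinAt ℝ s Q x) :
    H x (covDerivAt Q Γ x ξ (fun y => V y (s y))) = - splitAdag Q H V Γ x ξ (s x) := by
  rw [covDerivAt_clm_apply hQ hx hξ (hS.diff_V hx) hs, map_add, map_add, hS.H_V x hx, splitAdag,
    map_add, add_zero, neg_neg]

theorem inner_H_V (hS : IsSplitting Q g H V) (hx : x ∈ Q) (v w : E) :
    inner ℝ (H x v) (g x (V x w)) = 0 := by
  rw [hS.H_symm x hx, hS.H_V x hx, map_zero, inner_zero_right]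

theorem inner_comm (hS : IsSplitting Q g H V) (hx : x ∈ Q) (v w : E) :
    inner ℝ v (g x w) = inner ℝ w (g x v) := by
  rw [← hS.g_symm x hx, real_inner_comm]

end IsSplitting

/-! ### Metric identities for a Levi-Civita Christoffel function -/

theorem IsMetricChristoffel.fderivWithin_inner (hQ : IsLocalRetract Q)
    (hΓ : IsMetricChristoffel Q g Γ) (hg : ContDiffOn ℝ ∞ g Q) (hx : x ∈ Q)
    (hξ : ξ ∈ tangentSpaceAt Q x) {Y Z : E → E} (hY : IsVectorField Q Y) (hZ : IsVectorField Q Z) :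
    fderivWithin ℝ (fun y => inner ℝ (Y y) (g y (Z y))) Q x ξ =
      inner ℝ (covDerivAt Q Γ x ξ Y) (g x (Z x)) + inner ℝ (Y x) (g x (covDerivAt Q Γ x ξ Z)) := by
  have hY' := differentiableWithinAt_of_contDiffOn hY.1 hx
  have hZ' := differentiableWithinAt_of_contDiffOn hZ.1 hx
  have hg' := differentiableWithinAt_of_contDiffOn hg hx
  have h := hY'.hasFDerivWithinAt.inner ℝ (hg'.clm_apply hZ').hasFDerivWithinAt
  rw [hQ.fderivWithin_apply hx hξ h]
  simp only [ContinuousLinearMap.comp_apply, ContinuousLinearMap.prod_apply, fderivInnerCLM_apply]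
  rw [hQ.fderivWithin_clm_apply hx hξ hg' hZ', inner_add_right,
    hΓ.metric x hx ξ hξ _ (hY.2 x hx) _ (hZ.2 x hx), covDerivAt, covDerivAt, inner_add_left,
    map_add, inner_add_right]
  ring

theorem IsMetricChristoffel.torsion (hΓ : IsMetricChristoffel Q g Γ) (hx : x ∈ Q)
    {X Y : E → E} (hX : IsVectorField Q X) (hY : IsVectorField Q Y) :
    covDerivAt Q Γ x (X x) Y =
      covDerivAt Q Γ x (Y x) X + VectorField.lieBracketWithin ℝ X Y Q x := by
  rw [covDerivAt, covDerivAt, VectorField.lieBracketWithin,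
    hΓ.symm x hx _ (hX.2 x hx) _ (hY.2 x hx)]
  abel

/-- `A_ξ` and `A†_ξ` are adjoint: differentiate `⟨H v, V w⟩ = 0`. -/
theorem IsSplitting.inner_splitA (hS : IsSplitting Q g H V) (hQ : IsLocalRetract Q)
    (hΓ : IsMetricChristoffel Q g Γ) (hx : x ∈ Q) (hξ : ξ ∈ tangentSpaceAt Q x) (v w : E) :
    inner ℝ (splitA Q H V Γ x ξ v) (g x w) = inner ℝ v (g x (splitAdag Q H V Γ x ξ w)) := by
  have h := hΓ.fderivWithin_inner hQ hS.contDiffOn_g hx hξ (hS.isVectorField_H v)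
    (hS.isVectorField_V w)
  have h0 : fderivWithin ℝ (fun y => inner ℝ (H y v) (g y (V y w))) Q x = 0 := by
    rw [fderivWithin_congr (f := fun _ => (0 : ℝ)) (fun y hy => hS.inner_H_V hy v w)
      (hS.inner_H_V hx v w), fderivWithin_fun_const]
    rfl
  rw [h0] at h
  have h1 := hS.V_covDerivAt_H (Γ := Γ) hQ hx hξ (s := fun _ => v) (differentiableWithinAt_const v)
  have h2 := hS.H_covDerivAt_V (Γ := Γ) hQ hx hξ (s := fun _ => w) (differentiableWithinAt_const w)
  rw [← h1, hS.V_symm x hx, ← neg_neg (splitAdag Q H V Γ x ξ w), ← h2, map_neg, inner_neg_right,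
    ← hS.H_symm x hx]
  exact eq_neg_of_add_eq_zero_left h.symm

/-! ### The Gauss equation of the horizontal bundle -/

theorem IsSplitting.covDerivAt_horizontal (hS : IsSplitting Q g H V) (hQ : IsLocalRetract Q)
    (hΓH : IsHorizontalChristoffel Q H Γ ΓH) (hx : x ∈ Q) (hξ : ξ ∈ tangentSpaceAt Q x)
    {s : E → E} (hs : DifferentiableWithinAt ℝ s Q x) (hsH : ∀ y ∈ Q, H y (s y) = s y) :
    covDerivAt Q ΓH x ξ s = H x (covDerivAt Q Γ x ξ s) := by
  rw [covDerivAt_congr (fun y hy => (hsH y hy).symm) hx,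
    covDerivAt_congr (Γ := Γ) (fun y hy => (hsH y hy).symm) hx,
    covDerivAt_clm_apply hQ hx hξ (hS.diff_H hx) hs,
    covDerivAt_clm_apply hQ hx hξ (hS.diff_H hx) hs, hΓH x hx ξ hξ, map_add, map_add, hS.H_H x hx]
  have := hS.H_fderivWithin_H hQ hx hξ (s x)
  rw [← this]
  simp only [map_add, hS.H_H x hx, hS.H_fderivWithin_H_H hQ hx hξ]
  abel

/-- The Gauss equation of the horizontal bundle: horizontal part of the curvature of `∇` and
curvature of `H ∇`. -/
theorem IsSplitting.H_christoffelCurvature (hS : IsSplitting Q g H V) (hQ : IsLocalRetract Q)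
    (hΓ : ContDiffOn ℝ ∞ Γ Q) (hΓHs : ContDiffOn ℝ ∞ ΓH Q)
    (hΓH : IsHorizontalChristoffel Q H Γ ΓH)
    (hT : ∀ X Y, IsVectorField Q X → IsVectorField Q Y → IsVectorField Q (covDeriv Q Γ X Y))
    (hx : x ∈ Q) (ξ η φ : E) (hξ : H x ξ = ξ) (hη : H x η = η) (hφ : H x φ = φ) :
    H x (christoffelCurvature Q Γ x ξ η φ) = christoffelCurvature Q ΓH x ξ η φ
      - splitAdag Q H V Γ x ξ (splitA Q H V Γ x η φ)
      + splitAdag Q H V Γ x η (splitA Q H V Γ x ξ φ) := by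
  have hZ := hS.isVectorField_H φ
  have hZH : ∀ y ∈ Q, H y (H y φ) = H y φ := fun y hy => hS.H_H y hy φ
  have hcov : ∀ η, ∀ y ∈ Q, covDeriv Q ΓH (fun y => H y η) (fun y => H y φ) y =
      H y (covDeriv Q Γ (fun y => H y η) (fun y => H y φ) y) := fun η y hy =>
    hS.covDerivAt_horizontal hQ hΓH hy (hS.H_mem y hy _)
      (differentiableWithinAt_of_contDiffOn hZ.1 hy) hZH
  -- split `∇_Y Z` into its horizontal and vertical parts before the second differentiation
  have key : ∀ ξ η, H x ξ = ξ → H x η = η →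
      H x (covDerivAt Q Γ x ξ (covDeriv Q Γ (fun y => H y η) (fun y => H y φ))) =
      covDerivAt Q ΓH x ξ (covDeriv Q ΓH (fun y => H y η) (fun y => H y φ))
        - splitAdag Q H V Γ x ξ (splitA Q H V Γ x η φ) := by
    intro ξ η hξ hη
    have hξT : ξ ∈ tangentSpaceAt Q x := hξ ▸ hS.H_mem x hx ξ
    have hηT : η ∈ tangentSpaceAt Q x := hη ▸ hS.H_mem x hx η
    set W := covDeriv Q Γ (fun y => H y η) (fun y => H y φ) with hW
    have hWf : IsVectorField Q W := hT _ _ (hS.isVectorField_H η) hZ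
    have hWd := differentiableWithinAt_of_contDiffOn hWf.1 hx
    have hHWd := (hS.diff_H hx).clm_apply hWd
    have hVWd := (hS.diff_V hx).clm_apply hWd
    have hsum : covDerivAt Q Γ x ξ W = covDerivAt Q Γ x ξ (fun y => H y (W y)) +
        covDerivAt Q Γ x ξ (fun y => V y (W y)) := by
      rw [covDerivAt_congr (fun y hy => (hS.add_eq y hy _ (hWf.2 y hy)).symm) hx]
      simp only [covDerivAt, map_add]
      rw [hQ.fderivWithin_apply hx hξT (hHWd.hasFDerivWithinAt.fun_add hVWd.hasFDerivWithinAt)]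
      simp only [add_apply]
      abel
    have hVW : V x (W x) = splitA Q H V Γ x η φ := by
      have := hS.V_covDerivAt_H (Γ := Γ) hQ hx hηT (s := fun _ => φ)
        (differentiableWithinAt_const φ)
      rw [← this, hW, covDeriv, hη]
    rw [hsum, map_add, hS.H_covDerivAt_V hQ hx hξT hWd, ← hS.splitAdag_V hQ hx hξT (W x), hVW,
      covDerivAt_congr (hcov η) hx, hS.covDerivAt_horizontal hQ hΓH hx hξT hHWd
      fun y hy => hS.H_H y hy _]
    abel
  have hX := hS.isVectorField_H ξ
  have hY := hS.isVectorField_H η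
  have h1 := hQ.curvature_covDeriv hx hΓ hX hY hZ.1
  have h2 := hQ.curvature_covDeriv hx hΓHs hX hY hZ.1
  simp only [hξ, hη, hφ] at h1 h2
  rw [← h1, ← h2]
  simp only [curvature, map_sub]
  rw [covDeriv, covDeriv, covDeriv, covDeriv, covDeriv, covDeriv, hξ, hη, key ξ η hξ hη,
    key η ξ hη hξ, ← hS.covDerivAt_horizontal hQ hΓH hx (hQ.lieBracketWithin_mem hx hX hY)
      (differentiableWithinAt_of_contDiffOn hZ.1 hx) hZH]
  abel

end Splitting

/-! ### Horizontal lifts -/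

section Lift

open VectorField

variable {E : Type*} [NormedAddCommGroup E] [InnerProductSpace ℝ E]
  {F : Type*} [NormedAddCommGroup F] [NormedSpace ℝ F]

/-- `L x : F → E` is the horizontal lift to `x ∈ Q` of the vectors of `F` through the submersion
`p : Q → F`, and the differential of `p` is isometric on the range of `H` for the metric `G`
on `F`. The constant vectors of `F` are lifted to basic vector fields. -/
structure IsLift (Q : Set E) (g H : E → E →L[ℝ] E) (p : E → F) (G : F → F →L[ℝ] F →L[ℝ] ℝ)
    (L : E → F →L[ℝ] E) : Prop where
  contDiffOn_p : ContDiffOn ℝ ∞ p Q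
  contDiffOn_L : ContDiffOn ℝ ∞ L Q
  differentiableAt_G : ∀ x ∈ Q, DifferentiableAt ℝ G (p x)
  H_L : ∀ x ∈ Q, ∀ u, H x (L x u) = L x u
  fderivWithin_L : ∀ x ∈ Q, ∀ u, fderivWithin ℝ p Q x (L x u) = u
  L_fderivWithin : ∀ x ∈ Q, ∀ ξ ∈ tangentSpaceAt Q x, L x (fderivWithin ℝ p Q x ξ) = H x ξ
  isometry : ∀ x ∈ Q, ∀ u v, inner ℝ (L x u) (g x (L x v)) = G (p x) u v

/-- `γ` satisfies the Koszul formula of the metric `G` at the points of `S`. -/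
def IsKoszul (S : Set F) (G : F → F →L[ℝ] F →L[ℝ] ℝ) (γ : F → F → F → F) : Prop :=
  ∀ y ∈ S, ∀ u v z, 2 * G y (γ y u v) z =
    fderiv ℝ G y u v z + fderiv ℝ G y v u z - fderiv ℝ G y z u v

variable {Q : Set E} {g H V : E → E →L[ℝ] E} {Γ ΓH : E → E →L[ℝ] E →L[ℝ] E} {x : E}
  {p : E → F} {G : F → F →L[ℝ] F →L[ℝ] ℝ} {L : E → F →L[ℝ] E}

namespace IsLift

theorem isVectorField (hL : IsLift Q g H p G L) (hS : IsSplitting Q g H V) (u : F) :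
    IsVectorField Q (fun y => L y u) :=
  ⟨hL.contDiffOn_L.clm_apply contDiffOn_const, fun y hy => by
    have := hS.H_mem y hy (L y u)
    rwa [hL.H_L y hy u] at this⟩

theorem L_mem (hL : IsLift Q g H p G L) (hS : IsSplitting Q g H V) (hx : x ∈ Q) (u : F) :
    L x u ∈ tangentSpaceAt Q x :=
  (hL.isVectorField hS u).2 x hx

theorem fderivWithin_V (hL : IsLift Q g H p G L) (hS : IsSplitting Q g H V) (hx : x ∈ Q) (v : E) :
    fderivWithin ℝ p Q x (V x v) = 0 := by
  have h := hL.L_fderivWithin x hx _ (hS.V_mem x hx v)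
  rw [hS.H_V x hx] at h
  rw [← hL.fderivWithin_L x hx (fderivWithin ℝ p Q x (V x v)), h, map_zero]

/-- The bracket of two fields with constant images in `F` is vertical. -/
theorem H_lieBracketWithin (hL : IsLift Q g H p G L) (hQ : IsLocalRetract Q) (hx : x ∈ Q)
    {X Y : E → E} (hX : IsVectorField Q X) (hY : IsVectorField Q Y) {a b : F}
    (ha : ∀ y ∈ Q, fderivWithin ℝ p Q y (X y) = a)
    (hb : ∀ y ∈ Q, fderivWithin ℝ p Q y (Y y) = b) :
    H x (lieBracketWithin ℝ X Y Q x) = 0 := by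
  rw [← hL.L_fderivWithin x hx _ (hQ.lieBracketWithin_mem hx hX hY),
    ← hQ.fderivWithin_commutator hx hL.contDiffOn_p hX hY, fderivWithin_congr hb (hb x hx),
    fderivWithin_congr ha (ha x hx), fderivWithin_fun_const, fderivWithin_fun_const]
  simp

/-- Lifts exhaust the horizontal vectors, so that they detect horizontal parts. -/
theorem H_eq_zero (hL : IsLift Q g H p G L) (hS : IsSplitting Q g H V) (hx : x ∈ Q) {k : E}
    (h : ∀ z, inner ℝ k (g x (L x z)) = 0) : H x k = 0 := by
  refine hS.eq_zero x hx _ fun w => ?_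
  rw [hS.H_symm x hx, ← hS.H_H x hx, ← hL.L_fderivWithin x hx _ (hS.H_mem x hx w)]
  exact h _

/-- The products of basic fields are functions on the base. -/
theorem fderivWithin_inner_L (hL : IsLift Q g H p G L) (hQ : IsLocalRetract Q) (hx : x ∈ Q)
    {ξ : E} (hξ : ξ ∈ tangentSpaceAt Q x) (v z : F) :
    fderivWithin ℝ (fun y => inner ℝ (L y v) (g y (L y z))) Q x ξ =
      fderiv ℝ G (p x) (fderivWithin ℝ p Q x ξ) v z := by
  rw [fderivWithin_congr (fun y hy => hL.isometry y hy v z) (hL.isometry x hx v z)]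
  have hp := (differentiableWithinAt_of_contDiffOn hL.contDiffOn_p hx).hasFDerivWithinAt
  have hG : HasFDerivWithinAt (fun y => G (p y)) (fderiv ℝ G (p x) ∘L fderivWithin ℝ p Q x) Q x :=
    (hL.differentiableAt_G x hx).hasFDerivAt.comp_hasFDerivWithinAt (𝕜 := ℝ) (E := E) (F := F)
      (G := F →L[ℝ] F →L[ℝ] ℝ) (g := G) (f := p) x hp
  have h := (hG.clm_apply (hasFDerivWithinAt_const v x Q)).clm_apply (hasFDerivWithinAt_const z x Q)
  exact (hQ.fderivWithin_apply hx hξ h).trans (by simp)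

/-- For basic fields the Koszul formulas of `∇` and of the metric on `F` coincide: `H ∇_X Y` is
the lift of the covariant derivative downstairs. -/
theorem H_covDerivAt_L (hL : IsLift Q g H p G L) (hS : IsSplitting Q g H V)
    (hQ : IsLocalRetract Q) (hΓ : IsMetricChristoffel Q g Γ) {γ : F → F → F → F}
    (hγ : IsKoszul (p '' Q) G γ) (hx : x ∈ Q) (u v : F) :
    H x (covDerivAt Q Γ x (L x u) (fun y => L y v)) = L x (γ (p x) u v) := by
  have hvf := hL.isVectorField hS
  have htor : ∀ u v z, inner ℝ (covDerivAt Q Γ x (L x u) (fun y => L y v)) (g x (L x z)) =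
      inner ℝ (covDerivAt Q Γ x (L x v) (fun y => L y u)) (g x (L x z)) := by
    intro u v z
    have hb := hL.H_lieBracketWithin hQ hx (hvf u) (hvf v) (fun y hy => hL.fderivWithin_L y hy u)
      (fun y hy => hL.fderivWithin_L y hy v)
    rw [hΓ.torsion hx (hvf u) (hvf v), inner_add_left, ← hL.H_L x hx z,
      ← hS.H_symm x hx (lieBracketWithin _ _ _ _ _), hb, inner_zero_left, add_zero]
  have hmet : ∀ u v z, fderiv ℝ G (p x) u v z =
      inner ℝ (covDerivAt Q Γ x (L x u) (fun y => L y v)) (g x (L x z)) +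
      inner ℝ (covDerivAt Q Γ x (L x u) (fun y => L y z)) (g x (L x v)) := by
    intro u v z
    have h := hΓ.fderivWithin_inner hQ hS.contDiffOn_g hx (hL.L_mem hS hx u) (hvf v) (hvf z)
    rw [hL.fderivWithin_inner_L hQ hx (hL.L_mem hS hx u), hL.fderivWithin_L x hx,
      hS.inner_comm hx (L x v)] at h
    exact h
  refine sub_eq_zero.1 ?_
  rw [← hL.H_L x hx (γ (p x) u v), ← map_sub]
  refine hL.H_eq_zero hS hx fun z => ?_
  rw [inner_sub_left, hL.isometry x hx]
  linarith [hγ (p x) (mem_image_of_mem p hx) u v z, hmet u v z, hmet v u z, hmet z u v,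
    htor u v z, htor u z v, htor v z u]

theorem splitA_L (hL : IsLift Q g H p G L) (hS : IsSplitting Q g H V)
    (hQ : IsLocalRetract Q) (hx : x ∈ Q) (u v : F) :
    splitA Q H V Γ x (L x u) (L x v) = V x (covDerivAt Q Γ x (L x u) (fun y => L y v)) := by
  rw [covDerivAt_congr (fun y hy => (hL.H_L y hy v).symm) hx,
    hS.V_covDerivAt_H hQ hx (hL.L_mem hS hx u)
      (differentiableWithinAt_of_contDiffOn (hL.isVectorField hS v).1 hx)]

/-- `A` is skew on basic fields `X`, `Y`: `⟨∇_X Y + ∇_Y X, U⟩ = - U ⟨X, Y⟩` for `U` vertical, and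
`⟨X, Y⟩` is constant along the fibres. -/
theorem splitA_L_add (hL : IsLift Q g H p G L) (hS : IsSplitting Q g H V)
    (hQ : IsLocalRetract Q) (hΓ : IsMetricChristoffel Q g Γ) (hx : x ∈ Q) (u v : F) :
    splitA Q H V Γ x (L x u) (L x v) + splitA Q H V Γ x (L x v) (L x u) = 0 := by
  have hvf := hL.isVectorField hS
  refine hS.eq_zero x hx _ fun w => ?_
  have hU := hS.isVectorField_V w
  have key : ∀ u v, inner ℝ (splitA Q H V Γ x (L x u) (L x v)) (g x w) =
      - inner ℝ (L x v) (g x (covDerivAt Q Γ x (V x w) (fun y => L y u))) := by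
    intro u v
    have h := hΓ.fderivWithin_inner hQ hS.contDiffOn_g hx (hL.L_mem hS hx u) (hvf v) hU
    have h0 : ∀ y ∈ Q, inner ℝ (L y v) (g y (V y w)) = (0 : ℝ) := fun y hy => by
      rw [← hL.H_L y hy, hS.inner_H_V hy]
    rw [fderivWithin_congr (f := fun _ => (0 : ℝ)) h0 (h0 x hx), fderivWithin_fun_const,
      hΓ.torsion hx (hvf u) hU, map_add, inner_add_right] at h
    have hb := hL.H_lieBracketWithin hQ hx (hvf u) hU (fun y hy => hL.fderivWithin_L y hy u)
      (fun y hy => hL.fderivWithin_V hS hy w)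
    rw [← hL.H_L x hx v, hS.H_symm x hx _ (lieBracketWithin _ _ _ _ _), hb, map_zero,
      inner_zero_right, add_zero, hL.H_L x hx v] at h
    rw [hL.splitA_L hS hQ hx, hS.V_symm x hx]
    exact eq_neg_of_add_eq_zero_left h.symm
  have h := hΓ.fderivWithin_inner hQ hS.contDiffOn_g hx (hS.V_mem x hx w) (hvf u) (hvf v)
  rw [hL.fderivWithin_inner_L hQ hx (hS.V_mem x hx w), hL.fderivWithin_V hS hx, map_zero,
    hS.inner_comm hx (covDerivAt _ _ _ _ _)] at h
  rw [inner_add_left, key, key]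
  simp only [zero_apply] at h
  linarith

theorem splitA_swap (hL : IsLift Q g H p G L) (hS : IsSplitting Q g H V)
    (hQ : IsLocalRetract Q) (hΓ : IsMetricChristoffel Q g Γ) (hx : x ∈ Q) {ξ η : E}
    (hξ : H x ξ = ξ) (hη : H x η = η) :
    splitA Q H V Γ x ξ η = - splitA Q H V Γ x η ξ := by
  have hξ' := hL.L_fderivWithin x hx ξ (hξ ▸ hS.H_mem x hx ξ)
  have hη' := hL.L_fderivWithin x hx η (hη ▸ hS.H_mem x hx η)
  rw [hξ] at hξ'
  rw [hη] at hη'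
  rw [← hξ', ← hη']
  exact eq_neg_of_add_eq_zero_left (hL.splitA_L_add hS hQ hΓ hx _ _)

/-- O'Neill's computation. For basic fields `X`, `Y`, `Z` the second covariant derivatives of
`H ∇` are lifts of those downstairs, but `[X, Y]` has the vertical part `U = 2 A_X Y`, for which
`H ∇_U Z = H ∇_Z U = - A†_Z U`. -/
theorem christoffelCurvature_L (hL : IsLift Q g H p G L) (hS : IsSplitting Q g H V)
    (hQ : IsLocalRetract Q) (hΓ : IsMetricChristoffel Q g Γ) (hΓHs : ContDiffOn ℝ ∞ ΓH Q)
    (hΓH : IsHorizontalChristoffel Q H Γ ΓH) {γ : F → F → F → F}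
    (hγ : IsKoszul (p '' Q) G γ) (hx : x ∈ Q)
    (hγd : ∀ v w, DifferentiableAt ℝ (fun y => γ y v w) (p x)) (u v w : F) :
    christoffelCurvature Q ΓH x (L x u) (L x v) (L x w) =
      L x (fderiv ℝ (fun y => γ y v w) (p x) u - fderiv ℝ (fun y => γ y u w) (p x) v
        + γ (p x) u (γ (p x) v w) - γ (p x) v (γ (p x) u w))
      + (2 : ℝ) • splitAdag Q H V Γ x (L x w) (splitA Q H V Γ x (L x u) (L x v)) := by
  have hvf := hL.isVectorField hS
  have hd : ∀ u, DifferentiableWithinAt ℝ (fun y => L y u) Q x := fun u =>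
    differentiableWithinAt_of_contDiffOn (hvf u).1 hx
  have hcov : ∀ v w, ∀ y ∈ Q, covDeriv Q ΓH (fun y => L y v) (fun y => L y w) y =
      L y (γ (p y) v w) := fun v w y hy => by
    rw [covDeriv, hS.covDerivAt_horizontal hQ hΓH hy (hL.L_mem hS hy v)
      (differentiableWithinAt_of_contDiffOn (hvf w).1 hy) fun y hy => hL.H_L y hy w,
      hL.H_covDerivAt_L hS hQ hΓ hγ hy]
  have hp := (differentiableWithinAt_of_contDiffOn hL.contDiffOn_p hx).hasFDerivWithinAt
  have hLd := differentiableWithinAt_of_contDiffOn hL.contDiffOn_L hx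
  have hcov2 : ∀ u v w,
      covDerivAt Q ΓH x (L x u) (covDeriv Q ΓH (fun y => L y v) (fun y => L y w)) =
      L x (fderiv ℝ (fun y => γ y v w) (p x) u) + L x (γ (p x) u (γ (p x) v w)) := by
    intro u v w
    have hγp : HasFDerivWithinAt (fun y => γ (p y) v w)
        (fderiv ℝ (fun y => γ y v w) (p x) ∘L fderivWithin ℝ p Q x) Q x :=
      (hγd v w).hasFDerivAt.comp_hasFDerivWithinAt x hp
    have hγp' : fderivWithin ℝ (fun y => γ (p y) v w) Q x (L x u) =
        fderiv ℝ (fun y => γ y v w) (p x) u := by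
      refine (hQ.fderivWithin_apply hx (hL.L_mem hS hx u) hγp).trans ?_
      rw [ContinuousLinearMap.comp_apply, hL.fderivWithin_L x hx]
    rw [covDerivAt_congr (hcov v w) hx,
      covDerivAt_clm_apply hQ hx (hL.L_mem hS hx u) hLd hγp.differentiableWithinAt, hγp',
      ← hcov u _ x hx, covDeriv, covDerivAt_clm_const_apply hQ hx (hL.L_mem hS hx u) hLd]
    abel
  set U₀ := lieBracketWithin ℝ (fun y => L y u) (fun y => L y v) Q x with hU₀
  have hHU : H x U₀ = 0 := hL.H_lieBracketWithin hQ hx (hvf u) (hvf v)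
    (fun y hy => hL.fderivWithin_L y hy u) (fun y hy => hL.fderivWithin_L y hy v)
  have hUT := hQ.lieBracketWithin_mem hx (hvf u) (hvf v)
  have hVU : V x U₀ = U₀ := by
    have := hS.add_eq x hx _ hUT
    rwa [hHU, zero_add] at this
  have hUA : U₀ = (2 : ℝ) • splitA Q H V Γ x (L x u) (L x v) := by
    have h1 : U₀ = covDerivAt Q Γ x (L x u) (fun y => L y v)
        - covDerivAt Q Γ x (L x v) (fun y => L y u) :=
      eq_sub_of_add_eq' (hΓ.torsion hx (hvf u) (hvf v)).symm
    rw [← hVU, h1, map_sub, ← hL.splitA_L hS hQ hx, ← hL.splitA_L hS hQ hx,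
      eq_neg_of_add_eq_zero_right (hL.splitA_L_add hS hQ hΓ hx u v), two_smul, sub_neg_eq_add]
  -- the vertical vector `U₀` is extended by the vertical field `y ↦ V y U₀`
  have hlast : covDerivAt Q ΓH x U₀ (fun y => L y w) =
      - ((2 : ℝ) • splitAdag Q H V Γ x (L x w) (splitA Q H V Γ x (L x u) (L x v))) := by
    have hUf := hS.isVectorField_V U₀
    have htor := hΓ.torsion hx hUf (hvf w)
    have hb := hL.H_lieBracketWithin hQ hx hUf (hvf w) (fun y hy => hL.fderivWithin_V hS hy U₀)
      (fun y hy => hL.fderivWithin_L y hy w)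
    rw [hVU] at htor
    rw [hS.covDerivAt_horizontal hQ hΓH hx hUT (hd w) fun y hy => hL.H_L y hy w, htor, map_add, hb,
      add_zero, hS.H_covDerivAt_V (s := fun _ => U₀) hQ hx (hL.L_mem hS hx w)
        (differentiableWithinAt_const U₀), hUA,
      hS.splitAdag_eq hQ hx (hL.L_mem hS hx w), hS.splitAdag_eq hQ hx (hL.L_mem hS hx w)]
    simp only [map_smul, smul_sub]
  rw [← hQ.curvature_covDeriv hx hΓHs (hvf u) (hvf v) (hvf w).1, curvature, covDeriv, covDeriv,
    hcov2, hcov2, covDeriv, hlast]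
  simp only [map_add, map_sub]
  abel

end IsLift

end Lift

/-! ### The metric of the base in a chart -/

section Base

variable {F : Type*} [NormedAddCommGroup F] [NormedSpace ℝ F]
  {B : Type*} [TopologicalSpace B] [ChartedSpace F B] [IsManifold 𝓘(ℝ, F) ∞ B]

/-- The vector of `T_c B` with the coordinates `u` in the chart at `b`. -/
noncomputable def coordVector (b c : B) (u : F) : TangentSpace 𝓘(ℝ, F) c :=
  (trivializationAt F (TangentSpace 𝓘(ℝ, F) : B → Type _) b).symm c u

theorem contMDiffOn_coordVector (b : B) (u : F) :
    ContMDiffOn 𝓘(ℝ, F) (𝓘(ℝ, F).prod 𝓘(ℝ, F)) ∞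
      (fun c : B => Bundle.TotalSpace.mk' F c (coordVector b c u)) (chartAt F b).source := by
  have h := Bundle.Trivialization.contMDiffOn_section_baseSet_iff
    (trivializationAt F (TangentSpace 𝓘(ℝ, F) : B → Type _) b)
    (IB := 𝓘(ℝ, F)) (n := ∞) (s := fun c => coordVector b c u)
  rw [TangentBundle.trivializationAt_baseSet] at h
  refine h.2 ((contMDiffOn_const (c := u)).congr fun c hc => ?_)
  have := (trivializationAt F (TangentSpace 𝓘(ℝ, F) : B → Type _) b).apply_mk_symm
    (by rwa [TangentBundle.trivializationAt_baseSet]) u (b := c)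
  exact congrArg Prod.snd this

/-- `SemiRiemannianMetric.coord` pulls the metric back by the inverse of the trivialization of the
tangent bundle at `b`, from which it inherits smoothness. -/
theorem mfderiv_extChartAt_symm_apply (b : B) {y : F} (hy : y ∈ (extChartAt 𝓘(ℝ, F) b).target)
    (u : F) : mfderiv 𝓘(ℝ, F) 𝓘(ℝ, F) (extChartAt 𝓘(ℝ, F) b).symm y u =
      coordVector b ((extChartAt 𝓘(ℝ, F) b).symm y) u := by
  have hc : (extChartAt 𝓘(ℝ, F) b).symm y ∈ (chartAt F b).source := by
    rw [← extChartAt_source 𝓘(ℝ, F)]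
    exact (extChartAt 𝓘(ℝ, F) b).map_target hy
  have h := TangentBundle.symmL_trivializationAt (I := 𝓘(ℝ, F)) hc
  rw [(extChartAt 𝓘(ℝ, F) b).right_inv hy, modelWithCornersSelf_coe, range_id,
    mfderivWithin_univ] at h
  refine (congrArg (fun T : F →L[ℝ] F => T u) h).symm.trans ?_
  exact Bundle.Trivialization.symmL_apply _ (by rwa [TangentBundle.trivializationAt_baseSet]) u

namespace SemiRiemannianMetric

variable (h : SemiRiemannianMetric F B)

theorem contDiffOn_coord [FiniteDimensional ℝ F] (b : B) :
    ContDiffOn ℝ ∞ (h.coord b) (extChartAt 𝓘(ℝ, F) b).target := by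
  refine contDiffOn_clm_apply.2 fun u => contDiffOn_clm_apply.2 fun v => ?_
  have h1 : ContMDiffOn 𝓘(ℝ, F) (𝓘(ℝ, F).prod 𝓘(ℝ, ℝ)) ∞
      (fun c : B => Bundle.TotalSpace.mk' ℝ (E := Bundle.Trivial B ℝ) c
        (h.val c (coordVector b c u) (coordVector b c v))) (chartAt F b).source :=
    ContMDiffOn.clm_bundle_apply₂ (F₁ := F) (F₂ := F) h.contMDiff.contMDiffOn
      (contMDiffOn_coordVector b u) (contMDiffOn_coordVector b v)
  have h2 : ContMDiffOn 𝓘(ℝ, F) 𝓘(ℝ, ℝ) ∞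
      (fun c : B => h.val c (coordVector b c u) (coordVector b c v)) (chartAt F b).source := by
    intro c hc
    have := h1 c hc
    simp only [Bundle.contMDiffWithinAt_totalSpace] at this
    exact this.2
  have h3 := h2.comp (contMDiffOn_extChartAt_symm b) fun y hy => by
    rw [mem_preimage, ← extChartAt_source 𝓘(ℝ, F)]
    exact (extChartAt 𝓘(ℝ, F) b).map_target hy
  refine (contMDiffOn_iff_contDiffOn.1 h3).congr fun y hy => ?_
  simp only [Function.comp_apply, ← mfderiv_extChartAt_symm_apply b hy]
  rfl

theorem coord_isInvertible [FiniteDimensional ℝ F] (b : B) {y : F}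
    (hy : y ∈ (extChartAt 𝓘(ℝ, F) b).target) : (h.coord b y).IsInvertible := by
  have hA := isInvertible_mfderivWithin_extChartAt_symm (I := 𝓘(ℝ, F)) hy
  rw [modelWithCornersSelf_coe, range_id, mfderivWithin_univ] at hA
  have hinj : Function.Injective (h.coord b y : F →ₗ[ℝ] F →L[ℝ] ℝ) := by
    refine (injective_iff_map_eq_zero _).2 fun u hu => ?_
    refine hA.injective ((h.nondegenerate _ _ fun w => ?_).trans (map_zero _).symm)
    obtain ⟨v, rfl⟩ := hA.surjective w
    exact congrArg (fun T : F →L[ℝ] ℝ => T v) hu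
  have hdim : Module.finrank ℝ F = Module.finrank ℝ (F →L[ℝ] ℝ) := by
    rw [← (LinearMap.toContinuousLinearMap (𝕜 := ℝ) (E := F) (F' := ℝ)).finrank_eq]
    exact Subspace.dual_finrank_eq.symm
  refine ⟨(LinearMap.linearEquivOfInjective _ hinj hdim).toContinuousLinearEquiv, ?_⟩
  ext u
  rfl

theorem isKoszul_christoffel [FiniteDimensional ℝ F] (b : B) :
    IsKoszul (extChartAt 𝓘(ℝ, F) b).target (h.coord b) (h.christoffel b) := by
  intro y hy u v z
  rw [christoffel, (h.coord_isInvertible b hy).self_apply_inverse]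
  simp

set_option maxSynthPendingDepth 3 in
theorem contDiffOn_christoffel [FiniteDimensional ℝ F] (b : B) (u v : F) :
    ContDiffOn ℝ ∞ (fun y => h.christoffel b y u v) (extChartAt 𝓘(ℝ, F) b).target := by
  have : CompleteSpace F := FiniteDimensional.complete ℝ F
  have hG := h.contDiffOn_coord b
  have hdG : ContDiffOn ℝ ∞ (fderiv ℝ (h.coord b)) (extChartAt 𝓘(ℝ, F) b).target :=
    hG.fderiv_of_isOpen (isOpen_extChartAt_target b) (by simp)
  have hinv : ContDiffOn ℝ ∞ (fun y => (h.coord b y).inverse) (extChartAt 𝓘(ℝ, F) b).target :=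
    fun y hy => (h.coord_isInvertible b hy).contDiffAt_map_inverse.comp_contDiffWithinAt y (hG y hy)
  have hflip : ContDiffOn ℝ ∞ (fun y => ((fderiv ℝ (h.coord b) y).flip u).flip v)
      (extChartAt 𝓘(ℝ, F) b).target := contDiffOn_clm_apply.2 fun z =>
    ((hdG.clm_apply contDiffOn_const).clm_apply contDiffOn_const).clm_apply contDiffOn_const
  refine hinv.clm_apply
    (ContDiffOn.const_smul (1 / 2 : ℝ) (ContDiffOn.sub (ContDiffOn.add ?_ ?_) hflip))
  · exact (hdG.clm_apply contDiffOn_const).clm_apply contDiffOn_const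
  · exact (hdG.clm_apply contDiffOn_const).clm_apply contDiffOn_const

end SemiRiemannianMetric
end Base

/-! ### Restriction to relatively open subsets -/

section Restrict

variable {E : Type*} [NormedAddCommGroup E] [InnerProductSpace ℝ E]
  {Q U : Set E} {g H V : E → E →L[ℝ] E} {Γ ΓH : E → E →L[ℝ] E →L[ℝ] E} {x ξ : E}

theorem IsSplitting.inter_isOpen (hS : IsSplitting Q g H V) (hU : IsOpen U) :
    IsSplitting (Q ∩ U) g H V where
  contDiffOn_g := hS.contDiffOn_g.mono inter_subset_left
  contDiffOn_H := hS.contDiffOn_H.mono inter_subset_left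
  contDiffOn_V := hS.contDiffOn_V.mono inter_subset_left
  g_symm x hx := hS.g_symm x hx.1
  eq_zero x hx := hS.eq_zero x hx.1
  H_mem x hx := by rw [tangentSpaceAt_inter_isOpen hU hx.2]; exact hS.H_mem x hx.1
  V_mem x hx := by rw [tangentSpaceAt_inter_isOpen hU hx.2]; exact hS.V_mem x hx.1
  add_eq x hx := by rw [tangentSpaceAt_inter_isOpen hU hx.2]; exact hS.add_eq x hx.1
  H_H x hx := hS.H_H x hx.1
  H_V x hx := hS.H_V x hx.1
  V_H x hx := hS.V_H x hx.1
  V_V x hx := hS.V_V x hx.1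
  H_symm x hx := hS.H_symm x hx.1
  V_symm x hx := hS.V_symm x hx.1

theorem IsMetricChristoffel.inter_isOpen (hΓ : IsMetricChristoffel Q g Γ) (hU : IsOpen U) :
    IsMetricChristoffel (Q ∩ U) g Γ where
  contDiffOn := hΓ.contDiffOn.mono inter_subset_left
  symm x hx := by rw [tangentSpaceAt_inter_isOpen hU hx.2]; exact hΓ.symm x hx.1
  metric x hx := by
    rw [tangentSpaceAt_inter_isOpen hU hx.2, fderivWithin_inter (hU.mem_nhds hx.2)]
    exact hΓ.metric x hx.1

theorem IsHorizontalChristoffel.inter_isOpen (hΓH : IsHorizontalChristoffel Q H Γ ΓH)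
    (hU : IsOpen U) : IsHorizontalChristoffel (Q ∩ U) H Γ ΓH := by
  intro x hx
  rw [tangentSpaceAt_inter_isOpen hU hx.2, fderivWithin_inter (hU.mem_nhds hx.2)]
  exact hΓH x hx.1

theorem splitA_inter (hU : IsOpen U) (hx : x ∈ U) :
    splitA (Q ∩ U) H V Γ x = splitA Q H V Γ x := by
  ext ξ v
  rw [splitA, splitA, fderivWithin_inter (hU.mem_nhds hx)]

theorem splitAdag_inter (hU : IsOpen U) (hx : x ∈ U) :
    splitAdag (Q ∩ U) H V Γ x = splitAdag Q H V Γ x := by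
  ext ξ v
  rw [splitAdag, splitAdag, fderivWithin_inter (hU.mem_nhds hx)]

theorem christoffelCurvature_inter (hU : IsOpen U) (hx : x ∈ U) :
    christoffelCurvature (Q ∩ U) Γ x = christoffelCurvature Q Γ x := by
  ext ξ η φ
  rw [christoffelCurvature, christoffelCurvature, fderivWithin_inter (hU.mem_nhds hx)]

end Restrict

/-! ### The tangent projection and the Levi-Civita connection -/

section Tangent

variable {E : Type*} [NormedAddCommGroup E] [InnerProductSpace ℝ E] [FiniteDimensional ℝ E]
  {Q : Set E} {g : E → E →L[ℝ] E} {Γ : E → E →L[ℝ] E →L[ℝ] E} {x : E}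

/-- The metric projection onto the tangent space. -/
noncomputable def tProj (Q : Set E) (g : E → E →L[ℝ] E) (x : E) : E →L[ℝ] E :=
  metricProjection (g x) (tangentSpaceAt Q x)

theorem tProj_mem (x v : E) : tProj Q g x v ∈ tangentSpaceAt Q x :=
  metricProjection_mem _ _ _

theorem IsMetricOperator.tProj_eq_self (hg : IsMetricOperator Q g) (hx : x ∈ Q) {v : E}
    (hv : v ∈ tangentSpaceAt Q x) : tProj Q g x v = v :=
  metricProjection_eq_self (hg.symm x hx) (hg.nondegenerate x hx) hv

/-- Locally the differential of a retraction is a smooth family of projections onto the tangent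
spaces. -/
theorem IsMetricOperator.contDiffOn_tProj (hg : IsMetricOperator Q g) (hQ : IsLocalRetract Q) :
    ContDiffOn ℝ ∞ (tProj Q g) Q := by
  refine hQ.contDiffOn_of_local fun U r hr => ?_
  exact contDiffOn_metricProjection (hg.contDiffOn.mono inter_subset_left)
    ((hr.contDiffOn.fderiv_of_isOpen hr.isOpen (by simp)).mono inter_subset_right)
    (fun x hx => hg.symm x hx.1) (fun x hx => hg.nondegenerate x hx.1)
    (fun x hx v => hr.fderiv_mem hx.1 hx.2 v) (fun x hx v hv => hr.fderiv_of_mem hx.2 hv)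

theorem IsMetricOperator.isVectorField_tProj (hg : IsMetricOperator Q g) (hQ : IsLocalRetract Q)
    (v : E) : IsVectorField Q (fun y => tProj Q g y v) :=
  ⟨(hg.contDiffOn_tProj hQ).clm_apply contDiffOn_const, fun y _ => tProj_mem y v⟩

/-- Evaluate the Levi-Civita axioms on tangent projections of constant fields. -/
theorem IsLeviCivita.isMetricChristoffel (hLC : IsLeviCivita Q g (covDeriv Q Γ))
    (hg : IsMetricOperator Q g) (hQ : IsLocalRetract Q) (hΓ : ContDiffOn ℝ ∞ Γ Q) :
    IsMetricChristoffel Q g Γ where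
  contDiffOn := hΓ
  symm x hx ξ hξ η hη := by
    have h := hLC.torsion_free _ _ (hg.isVectorField_tProj hQ ξ) (hg.isVectorField_tProj hQ η) x hx
    simp only [covDeriv, covDerivAt, VectorField.lieBracketWithin, hg.tProj_eq_self hx hξ,
      hg.tProj_eq_self hx hη] at h
    rw [add_sub_add_comm] at h
    exact sub_eq_zero.1 (add_eq_left.1 h)
  metric x hx ξ hξ η hη ζ hζ := by
    have hY := hg.isVectorField_tProj hQ η
    have hZ := hg.isVectorField_tProj hQ ζ
    have h := hLC.metric_compatible _ _ _ (hg.isVectorField_tProj hQ ξ) hY hZ x hx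
    have hY' := differentiableWithinAt_of_contDiffOn hY.1 hx
    have hZ' := differentiableWithinAt_of_contDiffOn hZ.1 hx
    have hg' := differentiableWithinAt_of_contDiffOn hg.contDiffOn hx
    have h' := hY'.hasFDerivWithinAt.inner ℝ (hg'.clm_apply hZ').hasFDerivWithinAt
    simp only [hg.tProj_eq_self hx hξ, covDeriv] at h
    rw [hQ.fderivWithin_apply hx hξ h'] at h
    simp only [ContinuousLinearMap.comp_apply, ContinuousLinearMap.prod_apply,
      fderivInnerCLM_apply] at h
    rw [hQ.fderivWithin_clm_apply hx hξ hg' hZ'] at h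
    simp only [covDerivAt, hg.tProj_eq_self hx hη, hg.tProj_eq_self hx hζ, map_add,
      inner_add_left, inner_add_right] at h
    linarith

end Tangent

/-! ### The projections and the horizontal lift of a Riemannian submersion -/

section Submersion

variable {E : Type*} [NormedAddCommGroup E] [InnerProductSpace ℝ E]
  {F : Type*} [NormedAddCommGroup F] [NormedSpace ℝ F]
  {B : Type*} [TopologicalSpace B] [ChartedSpace F B] [IsManifold 𝓘(ℝ, F) ∞ B]
  {Q : Set E} {g : E → E →L[ℝ] E} {h : SemiRiemannianMetric F B} {π : E → B} {x q : E}

/-- The differential of the chart at `b`, at the point `c`. -/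
noncomputable def chartDiff (b c : B) : TangentSpace 𝓘(ℝ, F) c →L[ℝ] F :=
  mfderiv 𝓘(ℝ, F) 𝓘(ℝ, F) (extChartAt 𝓘(ℝ, F) b) c

theorem isInvertible_chartDiff {b c : B} (hc : c ∈ (extChartAt 𝓘(ℝ, F) b).source) :
    (chartDiff b c : TangentSpace 𝓘(ℝ, F) c →L[ℝ] F).IsInvertible :=
  isInvertible_mfderiv_extChartAt hc

theorem SemiRiemannianMetric.coord_chartDiff (h : SemiRiemannianMetric F B) {b c : B}
    (hc : c ∈ (extChartAt 𝓘(ℝ, F) b).source) (u v : TangentSpace 𝓘(ℝ, F) c) :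
    h.coord b (extChartAt 𝓘(ℝ, F) b c) (chartDiff b c u) (chartDiff b c v) = h.val c u v := by
  have hA := mfderivWithin_extChartAt_symm_comp_mfderiv_extChartAt' (I := 𝓘(ℝ, F)) hc
  rw [modelWithCornersSelf_coe, range_id, mfderivWithin_univ] at hA
  have hA' : ∀ u : F, (mfderiv 𝓘(ℝ, F) 𝓘(ℝ, F) (extChartAt 𝓘(ℝ, F) b).symm
      (extChartAt 𝓘(ℝ, F) b c) : F →L[ℝ] F) ((chartDiff b c : F →L[ℝ] F) u) = u :=
    fun u => congrArg (fun T : F →L[ℝ] F => T u) hA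
  -- all tangent spaces of `B` are `F` by definition, so that the base point can be rewritten
  have key : ∀ (val : B → F →L[ℝ] F →L[ℝ] ℝ) (c' : B) (a a' : F), c' = c → a = u → a' = v →
      val c' a a' = val c u v := by
    rintro val c' a a' rfl rfl rfl
    rfl
  exact key h.val _ _ _ ((extChartAt 𝓘(ℝ, F) b).left_inv hc) (hA' u) (hA' v)

theorem IsRiemannianSubmersion.hasFDerivWithinAt_chart (hπ : IsRiemannianSubmersion Q g π h)
    {b : B} (hx : x ∈ Q) (hb : π x ∈ (extChartAt 𝓘(ℝ, F) b).source) :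
    HasFDerivWithinAt (fun y => extChartAt 𝓘(ℝ, F) b (π y))
      ((chartDiff b (π x) : TangentSpace 𝓘(ℝ, F) (π x) →L[ℝ] F) ∘L diff F Q π x) Q x := by
  rw [extChartAt_source] at hb
  have h1 : HasMFDerivWithinAt 𝓘(ℝ, E) 𝓘(ℝ, F) π Q x (diff F Q π x) :=
    ((hπ.contMDiffOn x hx).mdifferentiableWithinAt (by simp)).hasMFDerivWithinAt
  have h2 : HasMFDerivAt 𝓘(ℝ, F) 𝓘(ℝ, F) (extChartAt 𝓘(ℝ, F) b) (π x) (chartDiff b (π x)) :=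
    (mdifferentiableAt_extChartAt hb).hasMFDerivAt
  exact (h2.comp_hasMFDerivWithinAt x h1).hasFDerivWithinAt

theorem IsRiemannianSubmersion.fderivWithin_chart (hπ : IsRiemannianSubmersion Q g π h)
    (hQ : IsLocalRetract Q) {b : B} (hx : x ∈ Q) (hb : π x ∈ (extChartAt 𝓘(ℝ, F) b).source)
    {ξ : E} (hξ : ξ ∈ tangentSpaceAt Q x) :
    fderivWithin ℝ (fun y => extChartAt 𝓘(ℝ, F) b (π y)) Q x ξ =
      chartDiff b (π x) (diff F Q π x ξ) :=
  hQ.fderivWithin_apply hx hξ (hπ.hasFDerivWithinAt_chart hx hb)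

theorem IsRiemannianSubmersion.exists_chart_nhds (hπ : IsRiemannianSubmersion Q g π h)
    (hq : q ∈ Q) : ∃ U : Set E, IsOpen U ∧ q ∈ U ∧
      (∀ x ∈ Q ∩ U, π x ∈ (extChartAt 𝓘(ℝ, F) (π q)).source) ∧
      ContDiffOn ℝ ∞ (fun y => extChartAt 𝓘(ℝ, F) (π q) (π y)) (Q ∩ U) := by
  have h1 := hπ.contMDiffOn.continuousOn q hq
    (extChartAt_source_mem_nhds (I := 𝓘(ℝ, F)) (π q))
  obtain ⟨U, hU, hqU, hsub⟩ := mem_nhdsWithin.1 h1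
  refine ⟨U, hU, hqU, fun x hx => hsub ⟨hx.2, hx.1⟩, contMDiffOn_iff_contDiffOn.1 ?_⟩
  refine contMDiffOn_extChartAt.comp (hπ.contMDiffOn.mono inter_subset_left) fun x hx => ?_
  rw [mem_preimage, ← extChartAt_source 𝓘(ℝ, F)]
  exact hsub ⟨hx.2, hx.1⟩

end Submersion

section RightInverse

variable {E : Type*} [NormedAddCommGroup E] [InnerProductSpace ℝ E]
  {F : Type*} [NormedAddCommGroup F] [NormedSpace ℝ F]
  {B : Type*} [TopologicalSpace B] [ChartedSpace F B] [IsManifold 𝓘(ℝ, F) ∞ B]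
  {Q : Set E} {g : E → E →L[ℝ] E} {h : SemiRiemannianMetric F B} {π : E → B} {x q : E}

theorem IsRiemannianSubmersion.eq_of_diff_eq (hπ : IsRiemannianSubmersion Q g π h)
    (hg : IsMetricOperator Q g)
    (hx : x ∈ Q) {v w : E} (hv : v ∈ horizontal F Q g π x) (hw : w ∈ horizontal F Q g π x)
    (hvw : diff F Q π x v = diff F Q π x w) : v = w := by
  have hvert : v - w ∈ vertical F Q π x :=
    ⟨sub_mem hv.1 hw.1, (map_sub (diff F Q π x) v w).trans (sub_eq_zero.2 hvw)⟩
  refine sub_eq_zero.1 (hπ.nondegenerate x hx _ hvert fun u hu => ?_)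
  rw [← hg.symm x hx, real_inner_comm]
  exact (sub_mem hv hw).2 u hu

variable [FiniteDimensional ℝ F]

/-- Near each point, a chart turns the submersion into a map `p` to `F`; composed with smooth
operators `R` with values in the tangent spaces on which `dπ` is onto, the differential of `p` has
smooth right inverses. -/
theorem IsRiemannianSubmersion.exists_rightInverse (hπ : IsRiemannianSubmersion Q g π h)
    (hQ : IsLocalRetract Q) (hq : q ∈ Q) {R : E → E →L[ℝ] E} (hR : ContDiffOn ℝ ∞ R Q)
    (hRT : ∀ x ∈ Q, ∀ v, R x v ∈ tangentSpaceAt Q x)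
    (hsurj : ∀ u : TangentSpace 𝓘(ℝ, F) (π q), ∃ v, diff F Q π q (R q v) = u) :
    ∃ (U : Set E) (M : E → F →L[ℝ] E), IsOpen U ∧ q ∈ U ∧
      (∀ x ∈ Q ∩ U, π x ∈ (extChartAt 𝓘(ℝ, F) (π q)).source) ∧
      ContDiffOn ℝ ∞ (fun y => extChartAt 𝓘(ℝ, F) (π q) (π y)) (Q ∩ U) ∧
      ContDiffOn ℝ ∞ M (Q ∩ U) ∧
      ContDiffOn ℝ ∞ (fun x =>
        fderivWithin ℝ (fun y => extChartAt 𝓘(ℝ, F) (π q) (π y)) (Q ∩ U) x ∘L R x) (Q ∩ U) ∧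
      (∀ x ∈ Q ∩ U, ∀ ξ ∈ tangentSpaceAt Q x,
        fderivWithin ℝ (fun y => extChartAt 𝓘(ℝ, F) (π q) (π y)) (Q ∩ U) x ξ =
          chartDiff (π q) (π x) (diff F Q π x ξ)) ∧
      ∀ x ∈ Q ∩ U, ∀ u,
        fderivWithin ℝ (fun y => extChartAt 𝓘(ℝ, F) (π q) (π y)) (Q ∩ U) x (R x (M x u)) = u := by
  obtain ⟨U, hU, hqU, hsrc, hp⟩ := hπ.exists_chart_nhds hq
  set p : E → F := fun y => extChartAt 𝓘(ℝ, F) (π q) (π y) with hpdef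
  have hQ' := hQ.inter_isOpen hU
  have hdp : ∀ x ∈ Q ∩ U, ∀ ξ ∈ tangentSpaceAt Q x,
      fderivWithin ℝ p (Q ∩ U) x ξ = chartDiff (π q) (π x) (diff F Q π x ξ) := fun x hx ξ hξ => by
    rw [fderivWithin_inter (hU.mem_nhds hx.2), hπ.fderivWithin_chart hQ hx.1 (hsrc x hx) hξ]
  have hD : ContDiffOn ℝ ∞ (fun x => fderivWithin ℝ p (Q ∩ U) x ∘L R x) (Q ∩ U) :=
    hQ'.contDiffOn_fderivWithin_comp hp (hR.mono inter_subset_left) fun x hx v => by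
      rw [tangentSpaceAt_inter_isOpen hU hx.2]
      exact hRT x hx.1 v
  obtain ⟨U', M, hU', hqU', hM, hDM⟩ := exists_local_rightInverse hD ⟨hq, hqU⟩ fun u => by
    obtain ⟨w, hw⟩ := (isInvertible_chartDiff (hsrc q ⟨hq, hqU⟩)).surjective u
    obtain ⟨v, hv⟩ := hsurj w
    refine ⟨v, ?_⟩
    rw [ContinuousLinearMap.comp_apply, hdp q ⟨hq, hqU⟩ _ (hRT q hq v), hv, hw]
  have hinter : Q ∩ (U ∩ U') = Q ∩ U ∩ U' := (inter_assoc _ _ _).symm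
  have hder : ∀ x ∈ Q ∩ (U ∩ U'),
      fderivWithin ℝ p (Q ∩ (U ∩ U')) x = fderivWithin ℝ p (Q ∩ U) x := fun x hx => by
    rw [hinter, fderivWithin_inter (hU'.mem_nhds hx.2.2)]
  have hsub : Q ∩ (U ∩ U') ⊆ Q ∩ U := fun x hx => ⟨hx.1, hx.2.1⟩
  refine ⟨U ∩ U', M, hU.inter hU', ⟨hqU, hqU'⟩, fun x hx => hsrc x (hsub hx), hp.mono hsub,
    hinter ▸ hM, (hD.mono hsub).congr fun x hx => ?_, fun x hx ξ hξ => ?_, fun x hx u => ?_⟩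
  · rw [hder x hx]
  · rw [hder x hx, hdp x (hsub hx) ξ hξ]
  · rw [hder x hx]
    exact hDM x (hsub hx) hx.2.2 u

end RightInverse

section SubmersionSplitting

variable {E : Type*} [NormedAddCommGroup E] [InnerProductSpace ℝ E] [FiniteDimensional ℝ E]
  {F : Type*} [NormedAddCommGroup F] [NormedSpace ℝ F]
  {B : Type*} [TopologicalSpace B] [ChartedSpace F B]
  {Q : Set E} {g : E → E →L[ℝ] E} {π : E → B} {x : E}

theorem vProj_mem (x v : E) : vProj F Q g π x v ∈ vertical F Q π x :=
  metricProjection_mem _ _ _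

theorem hProj_mem (x v : E) : hProj F Q g π x v ∈ horizontal F Q g π x :=
  metricProjection_mem _ _ _

variable [IsManifold 𝓘(ℝ, F) ∞ B] {h : SemiRiemannianMetric F B}

namespace IsRiemannianSubmersion

theorem vProj_eq_self (hπ : IsRiemannianSubmersion Q g π h) (hg : IsMetricOperator Q g)
    (hx : x ∈ Q) {v : E} (hv : v ∈ vertical F Q π x) : vProj F Q g π x v = v :=
  metricProjection_eq_self (hg.symm x hx) (hπ.nondegenerate x hx) hv

theorem tProj_sub_vProj_mem (hπ : IsRiemannianSubmersion Q g π h) (hg : IsMetricOperator Q g)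
    (hx : x ∈ Q) (v : E) : tProj Q g x v - vProj F Q g π x v ∈ horizontal F Q g π x := by
  refine ⟨sub_mem (tProj_mem x v) (vProj_mem x v).1, fun w hw => ?_⟩
  rw [map_sub, inner_sub_right, vProj,
    inner_metricProjection (hg.symm x hx) (hπ.nondegenerate x hx) hw, tProj,
    inner_metricProjection (hg.symm x hx) (hg.nondegenerate x hx) hw.1, sub_self]

theorem isNondegenerateOn_horizontal (hπ : IsRiemannianSubmersion Q g π h)
    (hg : IsMetricOperator Q g) (hx : x ∈ Q) :
    IsNondegenerateOn (g x) (horizontal F Q g π x) := by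
  intro v hv hvw
  refine hg.nondegenerate x hx v hv.1 fun w hw => ?_
  have h1 := hvw _ (hπ.tProj_sub_vProj_mem hg hx w)
  have h2 := hv.2 _ (vProj_mem (g := g) x w)
  rw [hg.tProj_eq_self hx hw, map_sub, inner_sub_right] at h1
  rw [← hg.symm x hx, real_inner_comm] at h2
  linarith

theorem hProj_eq (hπ : IsRiemannianSubmersion Q g π h) (hg : IsMetricOperator Q g) (hx : x ∈ Q) :
    hProj F Q g π x = tProj Q g x - vProj F Q g π x := by
  ext v
  refine metricProjection_eq (hg.symm x hx) (hπ.isNondegenerateOn_horizontal hg hx)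
    (hπ.tProj_sub_vProj_mem hg hx v) fun w hw => ?_
  have h2 := hw.2 _ (vProj_mem (g := g) x v)
  rw [sub_apply, map_sub, inner_sub_right, tProj,
    inner_metricProjection (hg.symm x hx) (hg.nondegenerate x hx) hw.1]
  rw [← hg.symm x hx, real_inner_comm] at h2
  rw [h2, sub_zero]

theorem hProj_eq_self (hπ : IsRiemannianSubmersion Q g π h) (hg : IsMetricOperator Q g)
    (hx : x ∈ Q) {v : E} (hv : v ∈ horizontal F Q g π x) : hProj F Q g π x v = v :=
  metricProjection_eq_self (hg.symm x hx) (hπ.isNondegenerateOn_horizontal hg hx) hv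

theorem diff_hProj (hπ : IsRiemannianSubmersion Q g π h) (hg : IsMetricOperator Q g)
    (hx : x ∈ Q) {v : E} (hv : v ∈ tangentSpaceAt Q x) :
    diff F Q π x (hProj F Q g π x v) = diff F Q π x v := by
  rw [hπ.hProj_eq hg hx, sub_apply, map_sub, hg.tProj_eq_self hx hv,
    show diff F Q π x (vProj F Q g π x v) = 0 from (vProj_mem x v).2, sub_zero]

variable [FiniteDimensional ℝ F] {q : E}

/-- With `M` a smooth right inverse of the differential of `π` in a chart, `1 - M dπ` is, on the
tangent spaces, a smooth family of projections onto the vertical spaces. -/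
theorem contDiffOn_vProj (hπ : IsRiemannianSubmersion Q g π h) (hg : IsMetricOperator Q g)
    (hQ : IsLocalRetract Q) : ContDiffOn ℝ ∞ (vProj F Q g π) Q := by
  refine contDiffOn_of_locally_contDiffOn fun q hq => ?_
  have hP := hg.contDiffOn_tProj hQ
  obtain ⟨U, M, hU, hqU, hsrc, -, hM, hD, hdp, hDM⟩ := hπ.exists_rightInverse hQ hq hP
    (fun x _ v => tProj_mem x v) fun u => by
      obtain ⟨v, hv, hvu⟩ := hπ.surjective q hq u
      exact ⟨v, by rw [hg.tProj_eq_self hq hv, hvu]⟩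
  refine ⟨U, hU, hqU, ?_⟩
  have hP' := hP.mono (inter_subset_left : Q ∩ U ⊆ Q)
  refine contDiffOn_metricProjection (hg.contDiffOn.mono inter_subset_left)
    (hP'.sub (hP'.clm_comp (hM.clm_comp hD))) (fun x hx => hg.symm x hx.1)
    (fun x hx => hπ.nondegenerate x hx.1) (fun x hx v => ?_) (fun x hx v hv => ?_)
  · have hmem := sub_mem (tProj_mem (Q := Q) (g := g) x v) (tProj_mem (g := g) x
      (M x (fderivWithin ℝ (fun y => extChartAt 𝓘(ℝ, F) (π q) (π y)) (Q ∩ U) x (tProj Q g x v))))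
    refine ⟨hmem, (isInvertible_chartDiff (hsrc x hx)).injective ?_⟩
    rw [map_zero]
    refine (hdp x hx _ hmem).symm.trans ?_
    rw [map_sub, hDM x hx, sub_self]
  · have hz : fderivWithin ℝ (fun y => extChartAt 𝓘(ℝ, F) (π q) (π y)) (Q ∩ U) x v = 0 := by
      rw [hdp x hx v hv.1, show diff F Q π x v = 0 from hv.2, map_zero]
    simp only [sub_apply, ContinuousLinearMap.comp_apply, hg.tProj_eq_self hx.1 hv.1, hz, map_zero,
      sub_zero]

theorem isSplitting (hπ : IsRiemannianSubmersion Q g π h) (hg : IsMetricOperator Q g)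
    (hQ : IsLocalRetract Q) : IsSplitting Q g (hProj F Q g π) (vProj F Q g π) := by
  have hadd : ∀ x ∈ Q, ∀ v, hProj F Q g π x v + vProj F Q g π x v = tProj Q g x v :=
    fun x hx v => by rw [hπ.hProj_eq hg hx, sub_apply, sub_add_cancel]
  have hHH : ∀ x ∈ Q, ∀ v, hProj F Q g π x (hProj F Q g π x v) = hProj F Q g π x v :=
    fun x hx v => hπ.hProj_eq_self hg hx (hProj_mem x v)
  have hVV : ∀ x ∈ Q, ∀ v, vProj F Q g π x (vProj F Q g π x v) = vProj F Q g π x v :=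
    fun x hx v => hπ.vProj_eq_self hg hx (vProj_mem x v)
  refine ⟨hg.contDiffOn, ?_, hπ.contDiffOn_vProj hg hQ, hg.symm, ?_, fun x _ v => (hProj_mem x v).1,
    fun x _ v => (vProj_mem x v).1, ?_, hHH, ?_, ?_, hVV, ?_, ?_⟩
  · exact ((hg.contDiffOn_tProj hQ).sub (hπ.contDiffOn_vProj hg hQ)).congr
      fun x hx => hπ.hProj_eq hg hx
  · intro x hx v hv
    obtain ⟨w, hw⟩ := (hg.invertible x hx).surjective v
    rw [← inner_self_eq_zero (𝕜 := ℝ), ← hv w, hw]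
  · intro x hx v hv
    rw [hadd x hx, hg.tProj_eq_self hx hv]
  · intro x hx v
    have := hadd x hx (vProj F Q g π x v)
    rw [hVV x hx, hg.tProj_eq_self hx (vProj_mem x v).1] at this
    exact add_eq_right.1 this
  · intro x hx v
    have := hadd x hx (hProj F Q g π x v)
    rw [hHH x hx, hg.tProj_eq_self hx (hProj_mem x v).1] at this
    exact add_eq_left.1 this
  · exact fun x hx => inner_metricProjection_comm (hg.symm x hx)
      (hπ.isNondegenerateOn_horizontal hg hx)
  · exact fun x hx => inner_metricProjection_comm (hg.symm x hx) (hπ.nondegenerate x hx)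

/-- The horizontal lift exists and is smooth near each point, in the chart at its image. -/
theorem exists_isLift (hπ : IsRiemannianSubmersion Q g π h) (hg : IsMetricOperator Q g)
    (hQ : IsLocalRetract Q) (hq : q ∈ Q) :
    ∃ (U : Set E) (L : E → F →L[ℝ] E), IsOpen U ∧ q ∈ U ∧
      (∀ x ∈ Q ∩ U, π x ∈ (extChartAt 𝓘(ℝ, F) (π q)).source) ∧
      IsLift (Q ∩ U) g (hProj F Q g π) (fun y => extChartAt 𝓘(ℝ, F) (π q) (π y))
        (h.coord (π q)) L := by
  have hS := hπ.isSplitting hg hQ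
  obtain ⟨U, M, hU, hqU, hsrc, hp, hM, hD, hdp, hDM⟩ := hπ.exists_rightInverse hQ hq hS.contDiffOn_H
    hS.H_mem fun u => by
      obtain ⟨v, hv, hvu⟩ := hπ.surjective q hq u
      exact ⟨v, by rw [hπ.diff_hProj hg hq hv, hvu]⟩
  have hcd : ∀ x ∈ Q ∩ U, ∀ u,
      chartDiff (π q) (π x) (diff F Q π x (hProj F Q g π x (M x u))) = u := fun x hx u => by
    rw [← hdp x hx _ (hS.H_mem x hx.1 _), hDM x hx]
  refine ⟨U, fun x => hProj F Q g π x ∘L M x, hU, hqU, hsrc, hp,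
    (hS.contDiffOn_H.mono inter_subset_left).clm_comp hM, fun x hx => ?_,
    fun x hx u => hS.H_H x hx.1 _, fun x hx u => hDM x hx u, fun x hx ξ hξ => ?_,
    fun x hx u v => ?_⟩
  · have ht := (extChartAt 𝓘(ℝ, F) (π q)).map_source (hsrc x hx)
    exact ((h.contDiffOn_coord (π q)).contDiffAt
      ((isOpen_extChartAt_target (π q)).mem_nhds ht)).differentiableAt (by simp)
  · rw [tangentSpaceAt_inter_isOpen hU hx.2] at hξ
    refine hπ.eq_of_diff_eq hg hx.1 (hProj_mem _ _) (hProj_mem _ _)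
      ((isInvertible_chartDiff (hsrc x hx)).injective ?_)
    rw [hπ.diff_hProj hg hx.1 hξ, ← hdp x hx ξ hξ]
    exact hcd x hx _
  · have h1 := hπ.isometry x hx.1 _ (hProj_mem x (M x u)) _ (hProj_mem x (M x v))
    rw [← h.coord_chartDiff (hsrc x hx), hcd x hx, hcd x hx] at h1
    exact h1.symm

end IsRiemannianSubmersion

end SubmersionSplitting

/-! ### The connection on the horizontal bundle of a submersion -/

section Connection

variable {E : Type*} [NormedAddCommGroup E] [InnerProductSpace ℝ E] [FiniteDimensional ℝ E]
  {F : Type*} [NormedAddCommGroup F] [NormedSpace ℝ F]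
  {B : Type*} [TopologicalSpace B] [ChartedSpace F B] [IsManifold 𝓘(ℝ, F) ∞ B]
  {Q : Set E} {g : E → E →L[ℝ] E} {h : SemiRiemannianMetric F B} {π : E → B}
  {Γ ΓH : E → E →L[ℝ] E →L[ℝ] E} {q ξ : E}

namespace IsRiemannianSubmersion

variable [FiniteDimensional ℝ F]

theorem isConnection_hConnection (hπ : IsRiemannianSubmersion Q g π h) (hg : IsMetricOperator Q g)
    (hQ : IsLocalRetract Q) (hΓ : ContDiffOn ℝ ∞ Γ Q) :
    IsConnection Q (horizontal F Q g π) (hConnection F Q g π Γ) where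
  isSection X s hX hs := ⟨(hπ.isSplitting hg hQ).contDiffOn_H.clm_apply
    (contDiffOn_covDeriv hQ hΓ hX hs.1), fun x _ => hProj_mem x _⟩
  add_left X X' s _ _ _ x _ := by
    simp only [hConnection, covDeriv, covDerivAt, map_add, add_apply]
    abel
  smul_left f X s _ _ _ x _ := by
    simp only [hConnection, covDeriv, covDerivAt, map_add, map_smul, smul_apply, smul_add]
  add_right X s s' hX hs hs' x hx := by
    have h1 := (differentiableWithinAt_of_contDiffOn hs.1 hx).hasFDerivWithinAt.fun_add
      (differentiableWithinAt_of_contDiffOn hs'.1 hx).hasFDerivWithinAt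
    simp only [hConnection, covDeriv, covDerivAt, map_add,
      hQ.fderivWithin_apply hx (hX.2 x hx) h1, add_apply]
    abel
  leibniz f X s hf hX hs x hx := by
    have h1 := (differentiableWithinAt_of_contDiffOn hf hx).hasFDerivWithinAt.fun_smul
      (differentiableWithinAt_of_contDiffOn hs.1 hx).hasFDerivWithinAt
    simp only [hConnection, covDeriv, covDerivAt,
      hQ.fderivWithin_apply hx (hX.2 x hx) h1, add_apply, smul_apply,
      ContinuousLinearMap.smulRight_apply, map_add, map_smul, hπ.hProj_eq_self hg hx (hs.2 x hx),
      smul_add]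
    abel

set_option maxSynthPendingDepth 3 in
/-- `Γ^H(ξ, v) = H Γ(ξ, v) - (D_{Tξ} H) v`, with `T` the tangent projection, is smooth and
bilinear on `E`. -/
theorem exists_isHorizontalChristoffel (hπ : IsRiemannianSubmersion Q g π h)
    (hg : IsMetricOperator Q g) (hQ : IsLocalRetract Q) (hΓ : ContDiffOn ℝ ∞ Γ Q) :
    ∃ ΓH, ContDiffOn ℝ ∞ ΓH Q ∧ IsHorizontalChristoffel Q (hProj F Q g π) Γ ΓH := by
  have hS := hπ.isSplitting hg hQ
  refine ⟨fun x => ContinuousLinearMap.compL ℝ E E E (hProj F Q g π x) ∘L Γ x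
    - fderivWithin ℝ (hProj F Q g π) Q x ∘L tProj Q g x, ?_, fun x hx ξ hξ v => ?_⟩
  · refine ContDiffOn.sub (ContDiffOn.clm_comp ?_ hΓ)
      (hQ.contDiffOn_fderivWithin_comp hS.contDiffOn_H (hg.contDiffOn_tProj hQ)
        fun x _ v => tProj_mem x v)
    exact (ContinuousLinearMap.compL ℝ E E E).contDiff.comp_contDiffOn hS.contDiffOn_H
  · simp [hg.tProj_eq_self hx hξ]

theorem isChristoffelFunction (hπ : IsRiemannianSubmersion Q g π h) (hg : IsMetricOperator Q g)
    (hQ : IsLocalRetract Q) (hΓHs : ContDiffOn ℝ ∞ ΓH Q)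
    (hΓH : IsHorizontalChristoffel Q (hProj F Q g π) Γ ΓH) :
    IsChristoffelFunction Q (horizontal F Q g π) (hConnection F Q g π Γ) ΓH where
  contDiffOn := hΓHs
  eq _ _ hX hs x hx := ((hπ.isSplitting hg hQ).covDerivAt_horizontal hQ hΓH hx (hX.2 x hx)
    (differentiableWithinAt_of_contDiffOn hs.1 hx)
    fun y hy => hπ.hProj_eq_self hg hy (hs.2 y hy)).symm

/-- Evaluate the Christoffel function on tangent projections and horizontal projections of constant
fields. -/
theorem isHorizontalChristoffel (hπ : IsRiemannianSubmersion Q g π h) (hg : IsMetricOperator Q g)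
    (hQ : IsLocalRetract Q)
    (hΓH : IsChristoffelFunction Q (horizontal F Q g π) (hConnection F Q g π Γ) ΓH) :
    IsHorizontalChristoffel Q (hProj F Q g π) Γ ΓH := by
  intro x hx ξ hξ v
  have hS := hπ.isSplitting hg hQ
  have hH := hS.isVectorField_H v
  have h1 := hΓH.eq _ (fun y => hProj F Q g π y v) (hg.isVectorField_tProj hQ ξ)
    ⟨hH.1, fun y _ => hProj_mem y v⟩ x hx
  have h2 := hS.H_fderivWithin_H hQ hx hξ v
  simp only [hConnection, covDeriv, hg.tProj_eq_self hx hξ] at h1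
  rw [covDerivAt_clm_const_apply hQ hx hξ (hS.diff_H hx),
    fderivWithin_clm_const_apply hQ hx hξ (hS.diff_H hx), map_add] at h1
  rw [← h2] at h1
  simp only [map_add, hS.H_fderivWithin_H_H hQ hx hξ, hS.H_H x hx, zero_add] at h1
  rw [eq_sub_iff_add_eq, ← add_right_inj (hProj F Q g π x (fderivWithin ℝ (hProj F Q g π) Q x ξ v)),
    h1]
  abel

/-! ### `A`, `A†` and the curvature formulas -/

theorem tensorA_eq_splitA (hπ : IsRiemannianSubmersion Q g π h) (hg : IsMetricOperator Q g)
    (hQ : IsLocalRetract Q) (hq : q ∈ Q) (hξ : ξ ∈ horizontal F Q g π q) (v : E) :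
    tensorA F Q g π Γ q ξ v = splitA Q (hProj F Q g π) (vProj F Q g π) Γ q ξ v := by
  rw [tensorA, covDeriv, hπ.hProj_eq_self hg hq hξ,
    covDerivAt_clm_const_apply hQ hq hξ.1 ((hπ.isSplitting hg hQ).diff_H hq), splitA]

theorem tensorAdag_eq_splitAdag (hπ : IsRiemannianSubmersion Q g π h) (hg : IsMetricOperator Q g)
    (hQ : IsLocalRetract Q) (hq : q ∈ Q) (hξ : ξ ∈ horizontal F Q g π q) (v : E) :
    tensorAdag F Q g π Γ q ξ v = splitAdag Q (hProj F Q g π) (vProj F Q g π) Γ q ξ v := by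
  rw [tensorAdag, covDerivAt_clm_const_apply hQ hq hξ.1 ((hπ.isSplitting hg hQ).diff_V hq),
    splitAdag]

theorem splitA_swap (hπ : IsRiemannianSubmersion Q g π h) (hg : IsMetricOperator Q g)
    (hQ : IsLocalRetract Q) (hΓ : IsMetricChristoffel Q g Γ) (hq : q ∈ Q) {ξ η : E}
    (hξ : ξ ∈ horizontal F Q g π q) (hη : η ∈ horizontal F Q g π q) :
    splitA Q (hProj F Q g π) (vProj F Q g π) Γ q ξ η =
      - splitA Q (hProj F Q g π) (vProj F Q g π) Γ q η ξ := by
  obtain ⟨U, L, hU, hqU, -, hL⟩ := hπ.exists_isLift hg hQ hq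
  have := hL.splitA_swap ((hπ.isSplitting hg hQ).inter_isOpen hU) (hQ.inter_isOpen hU)
    (hΓ.inter_isOpen hU) ⟨hq, hqU⟩ (hπ.hProj_eq_self hg hq hξ) (hπ.hProj_eq_self hg hq hη)
  rwa [splitA_inter hU hqU] at this

/-- The lift of the curvature of the base, by O'Neill's computation in the chart at `π q`. -/
theorem isHorizontalLift_curvature_iff (hπ : IsRiemannianSubmersion Q g π h)
    (hg : IsMetricOperator Q g) (hQ : IsLocalRetract Q) (hΓ : IsMetricChristoffel Q g Γ)
    (hΓHs : ContDiffOn ℝ ∞ ΓH Q) (hΓH : IsHorizontalChristoffel Q (hProj F Q g π) Γ ΓH)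
    (hq : q ∈ Q) {ξ η φ : E} (hξ : ξ ∈ horizontal F Q g π q) (hη : η ∈ horizontal F Q g π q)
    (hφ : φ ∈ horizontal F Q g π q) (R : E) :
    IsHorizontalLift F Q g π q
      (h.curvature (π q) (diff F Q π q ξ) (diff F Q π q η) (diff F Q π q φ)) R ↔
    R = christoffelCurvature Q ΓH q ξ η φ
      - (2 : ℝ) • splitAdag Q (hProj F Q g π) (vProj F Q g π) Γ q φ
        (splitA Q (hProj F Q g π) (vProj F Q g π) Γ q ξ η) := by
  obtain ⟨U, L, hU, hqU, hsrc, hL⟩ := hπ.exists_isLift hg hQ hq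
  have hqm : q ∈ Q ∩ U := ⟨hq, hqU⟩
  have ht := (extChartAt 𝓘(ℝ, F) (π q)).map_source (hsrc q hqm)
  have hdiff : ∀ v ∈ horizontal F Q g π q, L q (chartDiff (π q) (π q) (diff F Q π q v)) = v :=
    fun v hv => by
      have hvT : v ∈ tangentSpaceAt (Q ∩ U) q := by
        rw [tangentSpaceAt_inter_isOpen hU hqU]
        exact hv.1
      rw [← hπ.fderivWithin_chart hQ hq (hsrc q hqm) hv.1,
        ← fderivWithin_inter (hU.mem_nhds hqU), hL.L_fderivWithin q hqm v hvT,
        hπ.hProj_eq_self hg hq hv]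
  have hLmem : ∀ u, L q u ∈ horizontal F Q g π q := fun u => by
    rw [← hL.H_L q hqm]
    exact hProj_mem _ _
  have hinj : ∀ u, chartDiff (π q) (π q) (diff F Q π q (L q u)) = u := fun u => by
    rw [← hπ.fderivWithin_chart hQ hq (hsrc q hqm) (hLmem u).1,
      ← fderivWithin_inter (hU.mem_nhds hqU), hL.fderivWithin_L q hqm u]
  have hmain := hL.christoffelCurvature_L ((hπ.isSplitting hg hQ).inter_isOpen hU)
    (hQ.inter_isOpen hU) (hΓ.inter_isOpen hU) (hΓHs.mono inter_subset_left)
    (hΓH.inter_isOpen hU) (γ := h.christoffel (π q))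
    (fun y hy => h.isKoszul_christoffel (π q) y (by
      obtain ⟨x, hx, rfl⟩ := hy
      exact (extChartAt 𝓘(ℝ, F) (π q)).map_source (hsrc x hx))) hqm
    (fun v w => ((h.contDiffOn_christoffel (π q) v w).contDiffAt
      ((isOpen_extChartAt_target (π q)).mem_nhds ht)).differentiableAt (by simp))
    (chartDiff (π q) (π q) (diff F Q π q ξ)) (chartDiff (π q) (π q) (diff F Q π q η))
    (chartDiff (π q) (π q) (diff F Q π q φ))
  rw [hdiff ξ hξ, hdiff η hη, hdiff φ hφ, christoffelCurvature_inter hU hqU,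
    splitAdag_inter hU hqU, splitA_inter hU hqU] at hmain
  -- what remains is that `R` is the lift of the coordinate expression of the curvature
  rw [hmain, add_sub_cancel_right]
  have hc := isInvertible_chartDiff (F := F) (hsrc q hqm)
  constructor
  · rintro ⟨hR, hRd⟩
    rw [← hdiff R hR, hRd]
    exact congrArg (L q) (hc.self_apply_inverse _)
  · rintro rfl
    refine ⟨hLmem _, hc.injective ?_⟩
    rw [hinj]
    exact (hc.self_apply_inverse _).symm

end IsRiemannianSubmersion

end Connection

end EmbeddedGeometry

theorem mainTheorem6
    {E : Type*} [NormedAddCommGroup E] [InnerProductSpace ℝ E] [FiniteDimensional ℝ E]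
    {F : Type*} [NormedAddCommGroup F] [NormedSpace ℝ F] [FiniteDimensional ℝ F]
    {B : Type*} [TopologicalSpace B] [ChartedSpace F B] [IsManifold 𝓘(ℝ, F) ∞ B]
    (d : ℕ) (Q : Set E) (hQ : IsEmbeddedSubmanifold d Q)
    (g : E → E →L[ℝ] E) (hg : IsMetricOperator Q g)
    (h : SemiRiemannianMetric F B) (π : E → B) (hπ : IsRiemannianSubmersion Q g π h)
    (Γ : E → E →L[ℝ] E →L[ℝ] E) (hΓ : ContDiffOn ℝ ∞ Γ Q)
    (hLC : IsLeviCivita Q g (covDeriv Q Γ)) :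
    -- the two expressions of `A_ξ` and `A†_ξ`, and their adjointness
    (∀ q ∈ Q, ∀ ξ ∈ horizontal F Q g π q,
      (∀ v : E, tensorA F Q g π Γ q ξ v =
        - fderivWithin ℝ (vProj F Q g π) Q q ξ (hProj F Q g π q v)
          + vProj F Q g π q (Γ q ξ (hProj F Q g π q v))) ∧
      (∀ v : E, tensorAdag F Q g π Γ q ξ v =
        fderivWithin ℝ (hProj F Q g π) Q q ξ (vProj F Q g π q v)
          - hProj F Q g π q (Γ q ξ (vProj F Q g π q v))) ∧
      (∀ v₁ v₂ : E, inner ℝ (tensorA F Q g π Γ q ξ v₁) (g q v₂) =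
        inner ℝ v₁ (g q (tensorAdag F Q g π Γ q ξ v₂)))) ∧
    -- on horizontal vectors `A_ξ` is O'Neill's tensor
    (∀ q ∈ Q, ∀ ξ ∈ horizontal F Q g π q, ∀ v ∈ horizontal F Q g π q,
      ∀ X Y : E → E, IsVectorField Q X → IsVectorField Q Y → X q = ξ → Y q = v →
        tensorA F Q g π Γ q ξ v = oneillTensor F Q g π Γ X Y q) ∧
    -- `A_ξ η = ½ V [h_ξ, h_η] = ½ (H'(ξ) η - H'(η) ξ)`
    (∀ q ∈ Q, ∀ ξ ∈ horizontal F Q g π q, ∀ η ∈ horizontal F Q g π q,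
      tensorA F Q g π Γ q ξ η =
        (1 / 2 : ℝ) • vProj F Q g π q (VectorField.lieBracketWithin ℝ
          (fun y => hProj F Q g π y ξ) (fun y => hProj F Q g π y η) Q q) ∧
      tensorA F Q g π Γ q ξ η =
        (1 / 2 : ℝ) • (fderivWithin ℝ (hProj F Q g π) Q q ξ η
          - fderivWithin ℝ (hProj F Q g π) Q q η ξ)) ∧
    -- `∇^H` is a connection on the horizontal bundle, and it has a Christoffel function
    IsConnection Q (horizontal F Q g π) (hConnection F Q g π Γ) ∧
    (∃ ΓH, IsChristoffelFunction Q (horizontal F Q g π) (hConnection F Q g π Γ) ΓH) ∧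
    -- the horizontal lift of the curvature of `B` through any Christoffel function of `∇^H`
    (∀ ΓH, IsChristoffelFunction Q (horizontal F Q g π) (hConnection F Q g π Γ) ΓH →
      ∀ q ∈ Q, ∀ ξ ∈ horizontal F Q g π q, ∀ η ∈ horizontal F Q g π q,
      ∀ φ ∈ horizontal F Q g π q, ∀ R : E,
        IsHorizontalLift F Q g π q
          (h.curvature (π q) (diff F Q π q ξ) (diff F Q π q η) (diff F Q π q φ)) R ↔
        R = christoffelCurvature Q ΓH q ξ η φ
          - (2 : ℝ) • tensorAdag F Q g π Γ q φ (tensorA F Q g π Γ q ξ η)) ∧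
    -- O'Neill's curvature formula
    (∀ q ∈ Q, ∀ ξ ∈ horizontal F Q g π q, ∀ η ∈ horizontal F Q g π q,
      ∀ φ ∈ horizontal F Q g π q, ∀ X Y Z : E → E,
      IsVectorField Q X → IsVectorField Q Y → IsVectorField Q Z →
      X q = ξ → Y q = η → Z q = φ → ∀ R : E,
        IsHorizontalLift F Q g π q
          (h.curvature (π q) (diff F Q π q ξ) (diff F Q π q η) (diff F Q π q φ)) R ↔
        R = hProj F Q g π q (EmbeddedGeometry.curvature Q (covDeriv Q Γ) X Y Z q)
          - (2 : ℝ) • tensorAdag F Q g π Γ q φ (tensorA F Q g π Γ q ξ η)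
          + tensorAdag F Q g π Γ q ξ (tensorA F Q g π Γ q η φ)
          + tensorAdag F Q g π Γ q η (tensorA F Q g π Γ q φ ξ)) := by
  have hQr := hQ.isLocalRetract
  have hS := hπ.isSplitting hg hQr
  have hΓm := hLC.isMetricChristoffel hg hQr hΓ
  have hA : ∀ q ∈ Q, ∀ ξ ∈ horizontal F Q g π q, ∀ v, tensorA F Q g π Γ q ξ v =
      splitA Q (hProj F Q g π) (vProj F Q g π) Γ q ξ v := fun q hq ξ hξ v =>
    hπ.tensorA_eq_splitA hg hQr hq hξ v
  have hAd : ∀ q ∈ Q, ∀ ξ ∈ horizontal F Q g π q, ∀ v, tensorAdag F Q g π Γ q ξ v =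
      splitAdag Q (hProj F Q g π) (vProj F Q g π) Γ q ξ v := fun q hq ξ hξ v =>
    hπ.tensorAdag_eq_splitAdag hg hQr hq hξ v
  obtain ⟨Γ₀, hΓ₀s, hΓ₀⟩ := hπ.exists_isHorizontalChristoffel hg hQr hΓ
  refine ⟨fun q hq ξ hξ => ⟨fun v => ?_, fun v => ?_, fun v w => ?_⟩,
    fun q hq ξ hξ v hv X Y hX hY hXq hYq => ?_, fun q hq ξ hξ η hη => ?_,
    hπ.isConnection_hConnection hg hQr hΓ, ⟨Γ₀, hπ.isChristoffelFunction hg hQr hΓ₀s hΓ₀⟩,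
    fun ΓH hΓH q hq ξ hξ η hη φ hφ R => ?_,
    fun q hq ξ hξ η hη φ hφ X Y Z hX hY hZ hXq hYq hZq R => ?_⟩
  · rw [hA q hq ξ hξ, hS.splitA_eq hQr hq hξ.1]
  · rw [hAd q hq ξ hξ, hS.splitAdag_eq hQr hq hξ.1]
  · rw [hA q hq ξ hξ, hAd q hq ξ hξ, hS.inner_splitA hQr hΓm hq hξ.1]
  · have hYd := differentiableWithinAt_of_contDiffOn hY.1 hq
    -- `H ∇_ξ (V Y)` depends on `Y q` only through its vertical part, which vanishes
    have hadag : splitAdag Q (hProj F Q g π) (vProj F Q g π) Γ q ξ v = 0 := by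
      rw [← hS.splitAdag_V hQr hq hξ.1, ← hπ.hProj_eq_self hg hq hv, hS.V_H q hq,
        hS.splitAdag_eq hQr hq hξ.1]
      simp
    rw [hA q hq ξ hξ, oneillTensor]
    simp only [covDeriv]
    rw [hXq, hπ.hProj_eq_self hg hq hξ, hS.H_covDerivAt_V hQr hq hξ.1 hYd,
      hS.V_covDerivAt_H hQr hq hξ.1 hYd, hYq, hadag, neg_zero, zero_add]
  · have hX := hS.isVectorField_H ξ
    have hY := hS.isVectorField_H η
    have hbr : VectorField.lieBracketWithin ℝ (fun y => hProj F Q g π y ξ)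
        (fun y => hProj F Q g π y η) Q q =
        fderivWithin ℝ (hProj F Q g π) Q q ξ η - fderivWithin ℝ (hProj F Q g π) Q q η ξ := by
      rw [VectorField.lieBracketWithin, hπ.hProj_eq_self hg hq hξ, hπ.hProj_eq_self hg hq hη,
        fderivWithin_clm_const_apply hQr hq hξ.1 (hS.diff_H hq),
        fderivWithin_clm_const_apply hQr hq hη.1 (hS.diff_H hq)]
    -- the bracket of `h_ξ` and `h_η` is vertical at `q`
    have hVbr : vProj F Q g π q (fderivWithin ℝ (hProj F Q g π) Q q ξ η
        - fderivWithin ℝ (hProj F Q g π) Q q η ξ) =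
        fderivWithin ℝ (hProj F Q g π) Q q ξ η - fderivWithin ℝ (hProj F Q g π) Q q η ξ := by
      have h1 := hS.H_fderivWithin_H_H hQr hq hξ.1 η
      have h2 := hS.H_fderivWithin_H_H hQr hq hη.1 ξ
      rw [hπ.hProj_eq_self hg hq hη] at h1
      rw [hπ.hProj_eq_self hg hq hξ] at h2
      have h3 := hS.add_eq q hq _ (hbr ▸ hQr.lieBracketWithin_mem hq hX hY)
      rwa [map_sub (hProj F Q g π q), h1, h2, sub_zero, zero_add] at h3
    have htwo : (2 : ℝ) • splitA Q (hProj F Q g π) (vProj F Q g π) Γ q ξ η =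
        vProj F Q g π q (fderivWithin ℝ (hProj F Q g π) Q q ξ η
          - fderivWithin ℝ (hProj F Q g π) Q q η ξ) := by
      have hsw := hπ.splitA_swap hg hQr hΓm hq hξ hη
      rw [two_smul]
      nth_rw 2 [hsw]
      rw [splitA, splitA, hπ.hProj_eq_self hg hq hξ, hπ.hProj_eq_self hg hq hη,
        hΓm.symm q hq ξ hξ.1 η hη.1]
      simp only [map_add, map_sub]
      abel
    have hhalf : splitA Q (hProj F Q g π) (vProj F Q g π) Γ q ξ η = (1 / 2 : ℝ) •
        vProj F Q g π q (fderivWithin ℝ (hProj F Q g π) Q q ξ η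
          - fderivWithin ℝ (hProj F Q g π) Q q η ξ) := by
      rw [← htwo, smul_smul]
      norm_num
    rw [hA q hq ξ hξ, hbr]
    exact ⟨hhalf, hhalf.trans (by rw [hVbr])⟩
  · rw [hπ.isHorizontalLift_curvature_iff hg hQr hΓm hΓH.contDiffOn
      (hπ.isHorizontalChristoffel hg hQr hΓH) hq hξ hη hφ, hA q hq ξ hξ, hAd q hq φ hφ]
  · have hgauss := hS.H_christoffelCurvature hQr hΓ hΓ₀s hΓ₀
      (fun X Y hX hY => hLC.isConnection.isSection X Y hX hY) hq ξ η φ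
      (hπ.hProj_eq_self hg hq hξ) (hπ.hProj_eq_self hg hq hη) (hπ.hProj_eq_self hg hq hφ)
    have hneg : ∀ v, splitAdag Q (hProj F Q g π) (vProj F Q g π) Γ q η (-v) =
        - splitAdag Q (hProj F Q g π) (vProj F Q g π) Γ q η v := fun v => by
      simp only [splitAdag, map_neg, ← neg_add]
    rw [hπ.isHorizontalLift_curvature_iff hg hQr hΓm hΓ₀s hΓ₀ hq hξ hη hφ,
      hQr.curvature_covDeriv hq hΓ hX hY hZ.1, hXq, hYq, hZq, hgauss, hA q hq ξ hξ, hA q hq η hη,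
      hA q hq φ hφ, hAd q hq ξ hξ, hAd q hq η hη, hAd q hq φ hφ,
      hπ.splitA_swap hg hQr hΓm hq hφ hξ, hneg]
    refine Eq.congr_right ?_
    abel
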